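/- Let $k$ be any field and $\bar k$ an algebraic closure of $k$. A \emph{self-correspondence} over $\mathbb P^1_k$ is a smooth proper $k$-scheme $D$, every connected component of which is a geometrically irreducible curve, together with two $k$-morphisms $\pi_1,\pi_2 : D \to \mathbb P^1_k$ that are non-constant and separable on every connected component of $D$. For $z \in D(\bar k)$ let $e_{i,z}$ be the ramification index at $z$ of (the base change to $\bar k$ of) $\pi_i$. A subset $S \subset \mathbb P^1(\bar k)$ is \emph{complete} if $\pi_1^{-1}(S)=\pi_2^{-1}(S)$ in $D(\bar k)$; it is an \emph{irreducible complete set} if it is minimal among the non-empty complete sets; it is \emph{equiramified} if $e_{1,z}=e_{2,z}$ for every $z\in D(\bar k)$ with $\pi_1(z)\in S$ and $\pi_2(z) \in S$. The self-correspondence is \emph{finitary} if there is an integer $M$ such that every irreducible complete set is finite of cardinality at most $M$. \textbf{Proposition.} Let $D$ be a self-correspondence over $\mathbb P^1_k$ which is not finitary. Then there are at most two irreducible finite equiramified complete sets. If there are two of them, $S \neq S'$, then every irreducible finite complete set (equiramified or not) is equal to $S$ or to $S'$. -/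

import Mathlib

universe u

open CategoryTheory CategoryTheory.Limits AlgebraicGeometry

noncomputable section

namespace SelfCorr

/-- The spectrum of a field. -/
abbrev SpecOf (k : Type u) [Field k] : Scheme.{u} := Spec (CommRingCat.of k)

/-- The morphism `Spec K ⟶ Spec k` given by a field extension `k → K`. -/
abbrev specMap (k : Type u) [Field k] (K : Type u) [Field K] [Algebra k K] :
    SpecOf K ⟶ SpecOf k :=
  Spec.map (CommRingCat.ofHom (algebraMap k K))

/-- The projective line over `k`: `Proj k[X₀, X₁]` with the standard grading. -/
abbrev projectiveLine (k : Type u) [Field k] : Scheme.{u} :=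
  letI := MvPolynomial.gradedAlgebra (σ := Fin 2) (R := k)
  Proj (MvPolynomial.homogeneousSubmodule (Fin 2) k)

/-- The structure morphism of the projective line over `k`. -/
def projectiveLineToSpec (k : Type u) [Field k] : projectiveLine k ⟶ SpecOf k :=
  letI := MvPolynomial.gradedAlgebra (σ := Fin 2) (R := k)
  Proj.toSpecZero (MvPolynomial.homogeneousSubmodule (Fin 2) k) ≫
    Spec.map (CommRingCat.ofHom (algebraMap k (MvPolynomial.homogeneousSubmodule (Fin 2) k 0)))

/-- A morphism from (a component of) a smooth curve to a smooth curve is *non-constant and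
separable* if it is dominant and induces a separable extension of function fields. The function
field of the source is the residue field at its generic point. -/
structure IsNonconstantSeparable {X Y : Scheme.{u}} (f : X ⟶ Y) : Prop where
  isDominant : IsDominant f
  isSeparable : ∀ η : X, closure {η} = Set.univ →
    letI := (f.residueFieldMap η).hom.toAlgebra
    Algebra.IsSeparable (Y.residueField (f η)) (X.residueField η)

end SelfCorr

open SelfCorr in
/-- A self-correspondence on a curve `C` over `k` with structure morphism `c`: a smooth proper
`k`-scheme `D` with structure morphism `d`, each connected component of which is a geometrically
irreducible curve, with two `k`-morphisms `π₁ π₂ : D ⟶ C` which are non-constant and separable on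
every connected component of `D`. -/
structure SelfCorrespondence {k : Type u} [Field k] {C : Scheme.{u}} (c : C ⟶ SpecOf k) where
  D : Scheme.{u}
  d : D ⟶ SpecOf k
  π₁ : D ⟶ C
  π₂ : D ⟶ C
  π₁_comp : π₁ ≫ c = d
  π₂_comp : π₂ ≫ c = d
  isProper : IsProper d
  smooth : SmoothOfRelativeDimension 1 d
  component : ∀ x : D, ∃ U : D.Opens, (U : Set D) = connectedComponent x ∧
    GeometricallyIrreducible (U.ι ≫ d) ∧
    IsNonconstantSeparable (U.ι ≫ π₁) ∧
    IsNonconstantSeparable (U.ι ≫ π₂)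

namespace SelfCorr

variable {k : Type u} [Field k] (K : Type u) [Field K] [Algebra k K]
  {X Y : Scheme.{u}}

/-- The set `X(K)` of `K`-points of a `k`-scheme: morphisms of `k`-schemes `Spec K ⟶ X`. -/
abbrev Points (x : X ⟶ SpecOf k) : Type u :=
  {z : SpecOf K ⟶ X // z ≫ x = specMap k K}

/-- The base change `X_K` of a `k`-scheme `X` to `K`. -/
abbrev baseChange (x : X ⟶ SpecOf k) : Scheme.{u} := pullback x (specMap k K)

/-- The base change `X_K ⟶ Y_K` of a `k`-morphism `X ⟶ Y`. -/
def baseChangeMap {x : X ⟶ SpecOf k} {y : Y ⟶ SpecOf k} (f : X ⟶ Y) (hf : f ≫ y = x) :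
    baseChange K x ⟶ baseChange K y :=
  pullback.lift (pullback.fst x (specMap k K) ≫ f) (pullback.snd x (specMap k K))
    (by rw [Category.assoc, hf, pullback.condition])

variable {K}

/-- The map `X(K) → Y(K)` induced by a `k`-morphism `X ⟶ Y`. -/
def Points.map {x : X ⟶ SpecOf k} {y : Y ⟶ SpecOf k} (f : X ⟶ Y) (hf : f ≫ y = x)
    (z : Points K x) : Points K y :=
  ⟨z.1 ≫ f, by rw [Category.assoc, hf, z.2]⟩

/-- The section `Spec K ⟶ X_K` given by a `K`-point of `X`. -/
def Points.lift {x : X ⟶ SpecOf k} (z : Points K x) : SpecOf K ⟶ baseChange K x :=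
  pullback.lift z.1 (𝟙 (SpecOf K)) (by rw [z.2, Category.id_comp])

/-- The point of the base change `X_K` underlying a `K`-point of `X`. -/
def Points.toBaseChange {x : X ⟶ SpecOf k} (z : Points K x) : baseChange K x :=
  Points.lift z (IsLocalRing.closedPoint K)

/-- The ramification index of `f : X ⟶ Y` at a point `x` of `X`: the largest `e` such that the
maximal ideal of `𝒪_{Y, f x}` generates an ideal contained in the `e`-th power of the maximal
ideal of `𝒪_{X, x}`. -/
def ramificationIndexAt (f : X ⟶ Y) (x : X) : ℕ :=
  letI := (f.stalkMap x).hom.toAlgebra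
  Ideal.ramificationIdx' (IsLocalRing.maximalIdeal (Y.presheaf.stalk (f x)))
    (IsLocalRing.maximalIdeal (X.presheaf.stalk x))

/-- The ramification index of a `k`-morphism at a `K`-point `z` of the source, computed after
base change to `K`. -/
def ramificationIndex {x : X ⟶ SpecOf k} {y : Y ⟶ SpecOf k} (f : X ⟶ Y) (hf : f ≫ y = x)
    (z : Points K x) : ℕ :=
  ramificationIndexAt (baseChangeMap K f hf) (Points.toBaseChange z)

end SelfCorr

namespace SelfCorrespondence

open SelfCorr

variable {k : Type u} [Field k] {K : Type u} [Field K] [Algebra k K]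
  {C : Scheme.{u}} {c : C ⟶ SpecOf k} (D : SelfCorrespondence c)

/-- The source map `π₁ : D(K) → C(K)`. -/
def src (z : Points K D.d) : Points K c := Points.map D.π₁ D.π₁_comp z

/-- The target map `π₂ : D(K) → C(K)`. -/
def tgt (z : Points K D.d) : Points K c := Points.map D.π₂ D.π₂_comp z

/-- The ramification index `e_{1,z}` of `π₁` at `z`. -/
def e₁ (z : Points K D.d) : ℕ := ramificationIndex D.π₁ D.π₁_comp z

/-- The ramification index `e_{2,z}` of `π₂` at `z`. -/
def e₂ (z : Points K D.d) : ℕ := ramificationIndex D.π₂ D.π₂_comp z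

/-- A subset `S` of `C(K)` is complete if `π₁⁻¹(S) = π₂⁻¹(S)` in `D(K)`. -/
def IsComplete (S : Set (Points K c)) : Prop :=
  (D.src ⁻¹' S : Set (Points K D.d)) = D.tgt ⁻¹' S

/-- An irreducible complete set is a minimal non-empty complete set. -/
def IsIrreducibleComplete (S : Set (Points K c)) : Prop :=
  Minimal (fun T : Set (Points K c) => T.Nonempty ∧ D.IsComplete T) S

/-- `S` is equiramified if `e_{1,z} = e_{2,z}` for all `z ∈ D(K)` with both ends in `S`. -/
def IsEquiramified (S : Set (Points K c)) : Prop :=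
  ∀ z : Points K D.d, D.src z ∈ S → D.tgt z ∈ S → D.e₁ z = D.e₂ z

variable (K) in
/-- The self-correspondence is finitary if all its irreducible complete sets (in `C(K)`, with `K`
an algebraic closure of `k`) are finite, of cardinality bounded by some integer `M`. -/
def IsFinitary : Prop :=
  ∃ M : ℕ, ∀ S : Set (Points K c), D.IsIrreducibleComplete S → S.encard ≤ M

end SelfCorrespondence

end

/-!
Let `S` and `S'` be two finite equiramified irreducible complete sets, and let `h = F / G` be the
rational function on the projective line with divisor `|S'| • S - |S| • S'`. As `S` and `S'` are
complete and equiramified, on each component of `D` the functions `h ∘ π₁` and `h ∘ π₂` have the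
same divisor, hence differ by a constant. If there is a third finite irreducible complete set `T`,
then `h` takes finitely many values on `T`, all nonzero and finite, and multiplication by these
constants preserves this set of values; so the constants are roots of unity and a power `h ^ N`
satisfies `h ^ N ∘ π₁ = h ^ N ∘ π₂`. Every irreducible complete set then lies in a fibre of
`h ^ N`, whose cardinality is bounded: the correspondence is finitary.
-/

noncomputable section

namespace SelfCorr

section InvariantFunctions

variable {Z Q : Type*} {s t : Z → Q}

/-- Irreducible complete sets of the abstract correspondence with source map `s` and target map
`t`. For the maps `src` and `tgt` this unfolds to `SelfCorrespondence.IsIrreducibleComplete`. -/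
def IsIrreducibleCompleteSet (s t : Z → Q) (A : Set Q) : Prop :=
  Minimal (fun T : Set Q => T.Nonempty ∧ s ⁻¹' T = t ⁻¹' T) A

lemma IsIrreducibleCompleteSet.subset_of_inter_nonempty {A B : Set Q}
    (hA : IsIrreducibleCompleteSet s t A) (hB : s ⁻¹' B = t ⁻¹' B) (h : (A ∩ B).Nonempty) :
    A ⊆ B :=
  (hA.2 ⟨h, by rw [Set.preimage_inter, Set.preimage_inter, hA.1.2, hB]⟩
    Set.inter_subset_left).trans Set.inter_subset_right

lemma IsIrreducibleCompleteSet.eq_or_disjoint {A B : Set Q} (hA : IsIrreducibleCompleteSet s t A)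
    (hB : IsIrreducibleCompleteSet s t B) : A = B ∨ Disjoint A B := by
  rw [or_iff_not_imp_right, Set.not_disjoint_iff_nonempty_inter]
  intro h
  exact (hA.subset_of_inter_nonempty hB.1.2 h).antisymm
    (hB.subset_of_inter_nonempty hA.1.2 (Set.inter_comm A B ▸ h))

lemma IsIrreducibleCompleteSet.subset_fibre {V : Type*} {A : Set Q} {h : Q → V}
    (hA : IsIrreducibleCompleteSet s t A) (hh : ∀ z, h (s z) = h (t z)) {p : Q} (hp : p ∈ A) :
    A ⊆ {p' | h p' = h p} := by
  refine hA.subset_of_inter_nonempty (Set.ext fun z => ?_) ⟨p, hp, rfl⟩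
  simp only [Set.mem_preimage, Set.mem_ofPred_eq, hh]

lemma isOfFinOrder_of_forall_exists_eq_mul {K : Type*} [GroupWithZero K] {T : Set Q} {h : Q → K}
    {c : Kˣ} (hT : T.Finite) (h0 : ∃ p ∈ T, h p ≠ 0)
    (hmul : ∀ p ∈ T, ∃ p' ∈ T, h p' = c * h p) : IsOfFinOrder c := by
  obtain ⟨p, hp, hp0⟩ := h0
  have hmem (n : ℕ) : (c ^ n : Kˣ) * h p ∈ h '' T := by
    induction n with
    | zero => exact ⟨p, hp, by simp⟩
    | succ n ih =>
      obtain ⟨p₁, hp₁, h₁⟩ := ih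
      obtain ⟨p₂, hp₂, h₂⟩ := hmul p₁ hp₁
      exact ⟨p₂, hp₂, by rw [h₂, h₁, pow_succ', Units.val_mul, mul_assoc]⟩
  by_contra hc
  refine Set.infinite_of_injective_forall_mem (fun m n hmn => ?_) hmem (hT.image h)
  exact injective_pow_iff_not_isOfFinOrder.mpr hc (Units.ext (mul_right_cancel₀ hp0 hmn))

lemma exists_pow_invariant {K I : Type*} [CommGroupWithZero K] [Finite I] {h : Q → K}
    {c : I → Kˣ} {i : Z → I} (hh : ∀ z, h (s z) = c (i z) * h (t z))
    (ht : ∀ j p, ∃ z, i z = j ∧ t z = p) {T : Set Q} (hT : s ⁻¹' T = t ⁻¹' T) (hTf : T.Finite)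
    (h0 : ∃ p ∈ T, h p ≠ 0) : ∃ N ≠ 0, ∀ z, h (s z) ^ N = h (t z) ^ N := by
  have hc : IsOfFinOrder c := IsOfFinOrder.pi fun j =>
    isOfFinOrder_of_forall_exists_eq_mul hTf h0 fun p hp => by
      obtain ⟨z, rfl, rfl⟩ := ht j p
      exact ⟨s z, (Set.ext_iff.mp hT z).mpr hp, hh z⟩
  refine ⟨orderOf c, hc.orderOf_pos.ne', fun z => ?_⟩
  have hcz : c (i z) ^ orderOf c = 1 := congrFun (pow_orderOf_eq_one c) (i z)
  rw [hh, mul_pow, ← Units.val_pow_eq_pow_val, hcz, Units.val_one, one_mul]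

end InvariantFunctions

lemma encard_le_two_of_forall_eq_or_eq {α : Type*} {s : Set α}
    (h : ∀ a ∈ s, ∀ b ∈ s, a ≠ b → ∀ c ∈ s, c = a ∨ c = b) : s.encard ≤ 2 := by
  rcases s.subsingleton_or_nontrivial with hs | ⟨a, ha, b, hb, hab⟩
  · exact (Set.encard_le_one_iff_subsingleton.mpr hs).trans one_le_two
  · exact (Set.encard_le_encard (h a ha b hb hab)).trans (Set.encard_pair hab).le

section LocalAlgebra

variable {O : Type*} [CommRing O] [IsLocalRing O] [IsNoetherianRing O]

/- If a minimal prime `p` does not contain the generator `t`, then `p = t p`, so `p = 0`. -/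
lemma isDomain_of_maximalIdeal_eq_span {t : O}
    (ht : IsLocalRing.maximalIdeal O = Ideal.span {t}) (hreg : t ∈ nonZeroDivisors O) :
    IsDomain O := by
  obtain ⟨p, hp⟩ := Ideal.nonempty_minimalPrimes (bot_ne_top (α := Ideal O))
  have : p.IsPrime := hp.1.1
  have htp : t ∉ p := fun h => notMem_nonZeroDivisors_of_mem_mem_minimalPrimes h hp hreg
  have hle : p ≤ IsLocalRing.maximalIdeal O • p := by
    intro x hx
    obtain ⟨y, rfl⟩ :=
      Ideal.mem_span_singleton.mp (ht ▸ IsLocalRing.le_maximalIdeal_of_isPrime p hx)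
    exact Submodule.smul_mem_smul (ht ▸ Ideal.mem_span_singleton_self t)
      ((‹p.IsPrime›.mem_or_mem hx).resolve_left htp)
  have hbot : p = ⊥ := Submodule.eq_bot_of_le_smul_of_le_jacobson_bot _ _
    (IsNoetherian.noetherian _) hle (IsLocalRing.maximalIdeal_le_jacobson _)
  subst hbot
  exact .of_bot_isPrime O

lemma isDiscreteValuationRing_of_maximalIdeal_eq_span {t : O}
    (ht : IsLocalRing.maximalIdeal O = Ideal.span {t}) (hreg : t ∈ nonZeroDivisors O) :
    ∃ _ : IsDomain O, IsDiscreteValuationRing O := by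
  have := isDomain_of_maximalIdeal_eq_span ht hreg
  have hfield : ¬ IsField O := IsLocalRing.isField_iff_maximalIdeal_eq.not.mpr fun h =>
    nonZeroDivisors.ne_zero hreg (Ideal.span_singleton_eq_bot.mp (ht.symm.trans h))
  exact ⟨this, ((IsDiscreteValuationRing.TFAE O hfield).out 0 4 rfl rfl).mpr ⟨t, ht⟩⟩

lemma map_eq_maximalIdeal_pow_ramificationIdx' {A O : Type*} [CommRing A] [CommRing O] [IsDomain O]
    [IsDiscreteValuationRing O] [Algebra A O] {I : Ideal A} (hI : I.map (algebraMap A O) ≠ ⊥) :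
    I.map (algebraMap A O) =
      IsLocalRing.maximalIdeal O ^ I.ramificationIdx' (IsLocalRing.maximalIdeal O) := by
  obtain ⟨n, hn⟩ := exists_maximalIdeal_pow_eq_of_principal O inferInstance _ hI
  have hlt := Ideal.pow_right_strictAnti (IsLocalRing.maximalIdeal O)
    (IsDiscreteValuationRing.not_a_field O) Ideal.IsPrime.ne_top' n.lt_succ_self
  rw [Ideal.ramificationIdx'_spec hn.le (hn ▸ hlt.not_ge), hn]

section Etale

variable {B A : Type u} [CommRing B] [CommRing A] [Algebra B A] [Algebra.Etale B A] (q : Ideal A)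
  [q.IsPrime] (O : Type u) [CommRing O] [IsLocalRing O] [Algebra A O] [Algebra B O]
  [IsScalarTower B A O] [IsLocalization.AtPrime O q]

lemma maximalIdeal_eq_map_under_of_etale :
    IsLocalRing.maximalIdeal O = (q.under B).map (algebraMap B O) := by
  let := Localization.AtPrime.algebraOfLiesOver (q.under B) q
  have hmap := ((Algebra.isUnramifiedAt_iff_map_eq B (q.under B) q).mp inferInstance).2
  let e : Localization.AtPrime q ≃ₐ[A] O := IsLocalization.algEquiv q.primeCompl _ _
  rw [← IsLocalRing.map_ringEquiv_maximalIdeal e.toRingEquiv, ← hmap, ← Ideal.map_coe e.toRingEquiv,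
    Ideal.map_map]
  congr 1
  ext b
  change e (algebraMap _ _ _) = _
  rw [IsScalarTower.algebraMap_apply B A (Localization.AtPrime q), e.commutes,
    IsScalarTower.algebraMap_apply B A O]

lemma isDiscreteValuationRing_of_etale [IsDomain B] [IsNoetherianRing O] {b : B} (hb : b ≠ 0)
    (hq : q.under B = Ideal.span {b}) : ∃ _ : IsDomain O, IsDiscreteValuationRing O := by
  have : Module.Flat A O := IsLocalization.flat O q.primeCompl
  have : Module.Flat B O := Module.Flat.trans B A O
  have hreg : IsSMulRegular O b :=
    Module.Flat.isSMulRegular_of_nonZeroDivisors (mem_nonZeroDivisors_of_ne_zero hb)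
  refine isDiscreteValuationRing_of_maximalIdeal_eq_span (t := algebraMap B O b) ?_ ?_
  · rw [maximalIdeal_eq_map_under_of_etale q O (B := B), hq, Ideal.map_span, Set.image_singleton]
  · exact mem_nonZeroDivisors_iff_left.mpr fun x hx =>
      hreg.right_eq_zero_of_smul (by rw [Algebra.smul_def, hx])

end Etale

lemma isDiscreteValuationRing_of_isStandardSmoothOfRelativeDimension_one {R A : Type u}
    [CommRing R] [IsDomain R] [CommRing A] {f : R →+* A}
    (hf : f.IsStandardSmoothOfRelativeDimension 1) {ε : A →+* R} (hε : ε.comp f = .id R)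
    (q : Ideal A) [q.IsPrime] (hq : q = RingHom.ker ε) (O : Type u) [CommRing O] [IsLocalRing O]
    [IsNoetherianRing O] [Algebra A O] [IsLocalization.AtPrime O q] :
    ∃ _ : IsDomain O, IsDiscreteValuationRing O := by
  obtain ⟨g, hgf, hg⟩ := hf.exists_etale_mvPolynomial
  let e : Polynomial R ≃+* MvPolynomial (Fin 1) R :=
    (MvPolynomial.uniqueAlgEquiv R (Fin 1)).symm.toRingEquiv
  have hge : (g.comp e.toRingHom).Etale := RingHom.Etale.respectsIso.2 g e hg
  have hCf (c : R) : g (e (Polynomial.C c)) = f c := by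
    rw [← hgf]
    exact congrArg g ((MvPolynomial.uniqueAlgEquiv R (Fin 1)).symm.commutes c)
  let a := ε (g (e Polynomial.X))
  have hεge : ε.comp (g.comp e.toRingHom) = Polynomial.evalRingHom a := by
    refine Polynomial.ringHom_ext (fun c => ?_) (by simp [a])
    simpa [hCf] using RingHom.congr_fun hε c
  let := (g.comp e.toRingHom).toAlgebra
  have : Algebra.Etale (Polynomial R) A := hge
  let := ((algebraMap A O).comp (g.comp e.toRingHom)).toAlgebra
  have : IsScalarTower (Polynomial R) A O := .of_algebraMap_eq' rfl
  refine isDiscreteValuationRing_of_etale q O (Polynomial.X_sub_C_ne_zero a) ?_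
  rw [← Polynomial.ker_evalRingHom, ← hεge, ← RingHom.comap_ker, hq]
  rfl

end LocalAlgebra

section Constants

variable {k : Type u} [Field k] {X Y : Scheme.{u}}

/-- The inclusion of the constants `k` into the functions on an open subset of a `k`-scheme. -/
def constSection (f : X ⟶ SpecOf k) (U : X.Opens) : k →+* Γ(X, U) :=
  ((Scheme.ΓSpecIso (CommRingCat.of k)).inv ≫ f.appLE ⊤ U le_top).hom

/-- The inclusion of the constants `k` into a local ring of a `k`-scheme. -/
def constGerm (f : X ⟶ SpecOf k) (x : X) : k →+* X.presheaf.stalk x :=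
  ((Scheme.ΓSpecIso (CommRingCat.of k)).inv ≫ f.appTop ≫
    X.presheaf.germ ⊤ x (TopologicalSpace.Opens.mem_top x)).hom

lemma germ_constSection (f : X ⟶ SpecOf k) (U : X.Opens) (x : X) (hx : x ∈ U) (a : k) :
    X.presheaf.germ U x hx (constSection f U a) = constGerm f x a :=
  X.presheaf.germ_res_apply _ _ _ _

lemma stalkSpecializes_constGerm (f : X ⟶ SpecOf k) {x y : X} (h : x ⤳ y) (a : k) :
    X.presheaf.stalkSpecializes h (constGerm f y a) = constGerm f x a :=
  X.presheaf.germ_stalkSpecializes_apply _ _ _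

lemma stalkMap_constGerm {f : X ⟶ SpecOf k} {g : Y ⟶ SpecOf k} (φ : X ⟶ Y) (h : φ ≫ g = f)
    (x : X) (a : k) : φ.stalkMap x (constGerm g (φ x) a) = constGerm f x a := by
  subst h
  exact Scheme.Hom.germ_stalkMap_apply φ ⊤ x (TopologicalSpace.Opens.mem_top _) _

/-- The value at the rational point `s` of a germ of functions at that point. -/
def evalAt (s : SpecOf k ⟶ X) : X.presheaf.stalk (s (IsLocalRing.closedPoint k)) →+* k :=
  (Scheme.stalkClosedPointTo s).hom

lemma evalAt_constGerm {f : X ⟶ SpecOf k} {s : SpecOf k ⟶ X} (hs : s ≫ f = 𝟙 _) (a : k) :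
    evalAt s (constGerm f _ a) = a := by
  have hstalk := stalkMap_constGerm s hs (IsLocalRing.closedPoint k) a
  refine (congrArg (stalkClosedPointIso (CommRingCat.of k)).hom hstalk).trans ?_
  have hgerm := congr($(germ_stalkClosedPointIso_hom (CommRingCat.of k))
    ((Scheme.ΓSpecIso (CommRingCat.of k)).inv a))
  simpa [constGerm] using hgerm

lemma evalAt_eq_zero_iff (s : SpecOf k ⟶ X)
    (y : X.presheaf.stalk (s (IsLocalRing.closedPoint k))) :
    evalAt s y = 0 ↔ y ∈ IsLocalRing.maximalIdeal _ := by
  rw [IsLocalRing.mem_maximalIdeal, mem_nonunits_iff,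
    ← isUnit_map_iff (Scheme.stalkClosedPointTo s).hom, isUnit_iff_ne_zero, not_not]
  rfl

lemma evalAt_comp (s : SpecOf k ⟶ X) (φ : X ⟶ Y)
    (y : Y.presheaf.stalk (φ (s (IsLocalRing.closedPoint k)))) :
    evalAt (s ≫ φ) y = evalAt s (φ.stalkMap _ y) :=
  congr($(Scheme.stalkClosedPointTo_comp s φ) y)

lemma exists_isDiscreteValuationRing_stalk {f : X ⟶ SpecOf k} [SmoothOfRelativeDimension 1 f]
    {s : SpecOf k ⟶ X} (hs : s ≫ f = 𝟙 _) :
    ∃ _ : IsDomain (X.presheaf.stalk (s (IsLocalRing.closedPoint k))),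
      IsDiscreteValuationRing (X.presheaf.stalk (s (IsLocalRing.closedPoint k))) := by
  set x := s (IsLocalRing.closedPoint k)
  have : Smooth f := SmoothOfRelativeDimension.smooth 1 f
  have : IsLocallyNoetherian X := LocallyOfFiniteType.isLocallyNoetherian f
  obtain ⟨U, hU, V, hV, hxV, e, hf⟩ :=
    SmoothOfRelativeDimension.exists_isStandardSmoothOfRelativeDimension (n := 1) (f := f) x
  obtain rfl : U = ⊤ := by
    ext y
    simpa using (Subsingleton.elim y (f x)) ▸ e hxV
  have hstd : (constSection f V).IsStandardSmoothOfRelativeDimension 1 :=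
    (RingHom.isStandardSmoothOfRelativeDimension_respectsIso).2 _
      (Scheme.ΓSpecIso (CommRingCat.of k)).symm.commRingCatIsoToRingEquiv hf
  let := TopCat.Presheaf.algebra_section_stalk X.presheaf ⟨x, hxV⟩
  have := hV.isLocalization_stalk ⟨x, hxV⟩
  refine isDiscreteValuationRing_of_isStandardSmoothOfRelativeDimension_one hstd
    (ε := (evalAt s).comp (X.presheaf.germ V x hxV).hom) ?_ (hV.primeIdealOf ⟨x, hxV⟩).asIdeal ?_ _
  · ext a
    exact (congrArg _ (germ_constSection f V x hxV a)).trans (evalAt_constGerm hs a)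
  · ext y
    rw [hV.primeIdealOf_eq_map_closedPoint]
    exact (evalAt_eq_zero_iff s _).symm

end Constants

section ClosedPoints

variable {X : Scheme.{u}}

lemma section_eq_zero_of_germ_eq_zero_of_isClosed [JacobsonSpace X] {U : X.Opens} (s : Γ(X, U))
    (h : ∀ x (hx : x ∈ U), IsClosed {x} → X.presheaf.germ U x hx s = 0) : s = 0 := by
  let V : X.Opens := sSup {W | ∃ hW : W ≤ U, X.presheaf.map (homOfLE hW).op s = 0}
  have mem_V {x : X} (hx : x ∈ U) : x ∈ V ↔ X.presheaf.germ U x hx s = 0 := by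
    refine ⟨fun hxV => ?_, fun hs => ?_⟩
    · obtain ⟨W, ⟨hW, hsW⟩, hxW⟩ := TopologicalSpace.Opens.mem_sSup.mp hxV
      rw [← X.presheaf.germ_res_apply (homOfLE hW) x hxW s, hsW, map_zero]
    · obtain ⟨W, hxW, i, _, hsW⟩ := X.presheaf.germ_eq x hx hx s 0 (by rw [hs, map_zero])
      exact TopologicalSpace.Opens.mem_sSup.mpr ⟨W, ⟨i.le, by rwa [map_zero] at hsW⟩, hxW⟩
  refine TopCat.Presheaf.section_ext X.sheaf U s 0 fun x hx => ?_
  rw [map_zero]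
  by_contra hne
  obtain ⟨y, ⟨hyU, hyV⟩, hy⟩ := nonempty_inter_closedPoints
    (Z := (U : Set X) ∩ (V : Set X)ᶜ) ⟨x, hx, fun hxV => hne ((mem_V hx).mp hxV)⟩
    (U.2.isLocallyClosed.inter V.2.isClosed_compl.isLocallyClosed)
  exact hyV ((mem_V hyU).mpr (h y hyU hy))

lemma isReduced_of_isReduced_stalk_of_isClosed [JacobsonSpace X]
    (h : ∀ x : X, IsClosed {x} → _root_.IsReduced (X.presheaf.stalk x)) : IsReduced X :=
  ⟨fun U => ⟨fun s hs => section_eq_zero_of_germ_eq_zero_of_isClosed s fun x hxU hx =>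
    have := h x hx
    (hs.map (X.presheaf.germ U x hxU).hom).eq_zero⟩⟩

lemma iSup_opens_eq_top_of_isClosed [CompactSpace X] {ι : Type*} {U : ι → X.Opens}
    (h : ∀ x : X, IsClosed {x} → ∃ i, x ∈ U i) : iSup U = ⊤ := by
  by_contra hU
  obtain ⟨x, hxU, hx⟩ := (iSup U).2.isClosed_compl.exists_closed_singleton
    (Set.nonempty_compl.mpr fun hcoe => hU (TopologicalSpace.Opens.ext hcoe))
  obtain ⟨i, hi⟩ := h x hx
  exact hxU (TopologicalSpace.Opens.mem_iSup.mpr ⟨i, hi⟩)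

lemma exists_germ_genericPoint_eq_of_iSup_eq_top [IsIntegral X] {ι : Type*} {U : ι → X.Opens}
    (hU : iSup U = ⊤) (hgen : ∀ i, genericPoint X ∈ U i) (s : ∀ i, Γ(X, U i)) {g : X.functionField}
    (hs : ∀ i, X.presheaf.germ (U i) (genericPoint X) (hgen i) (s i) = g) :
    ∃ a : Γ(X, ⊤), X.presheaf.germ ⊤ (genericPoint X) (TopologicalSpace.Opens.mem_top _) a = g := by
  obtain ⟨a, ha, -⟩ := X.sheaf.existsUnique_gluing' U ⊤ (fun i => homOfLE le_top) hU.ge s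
    fun i j => germ_injective_of_isIntegral X (U := U i ⊓ U j) _ ⟨hgen i, hgen j⟩ <|
      (X.presheaf.germ_res_apply _ _ _ _).trans <|
        ((hs i).trans (hs j).symm).trans (X.presheaf.germ_res_apply _ _ _ _).symm
  obtain ⟨i, -⟩ : ∃ i, genericPoint X ∈ U i :=
    TopologicalSpace.Opens.mem_iSup.mp (hU ▸ TopologicalSpace.Opens.mem_top _)
  refine ⟨a, ?_⟩
  rw [← hs i, ← ha i]
  exact (X.presheaf.germ_res_apply _ _ _ _).symm

lemma exists_germ_genericPoint_eq_of_isClosed [IsIntegral X] [CompactSpace X]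
    {g : X.functionField} (h : ∀ x : X, IsClosed {x} → ∃ w : X.presheaf.stalk x,
      algebraMap (X.presheaf.stalk x) X.functionField w = g) :
    ∃ a : Γ(X, ⊤), X.presheaf.germ ⊤ (genericPoint X) (TopologicalSpace.Opens.mem_top _) a = g := by
  have exists_section (x : closedPoints X) : ∃ (U : X.Opens) (_ : x.1 ∈ U) (s : Γ(X, U)),
      ∀ hU : genericPoint X ∈ U, X.presheaf.germ U (genericPoint X) hU s = g := by
    obtain ⟨w, rfl⟩ := h x.1 x.2
    obtain ⟨U, hxU, s, rfl⟩ := X.presheaf.exists_germ_eq w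
    exact ⟨U, hxU, s, fun _ => (X.presheaf.germ_stalkSpecializes_apply _ _ _).symm⟩
  choose U hxU s hs using exists_section
  have hgen (x) : genericPoint X ∈ U x :=
    ((genericPoint_spec X).mem_open_set_iff (U x).2).mpr ⟨x.1, trivial, hxU x⟩
  exact exists_germ_genericPoint_eq_of_iSup_eq_top
    (iSup_opens_eq_top_of_isClosed fun x hx => ⟨⟨x, hx⟩, hxU ⟨x, hx⟩⟩) hgen s fun x => hs x (hgen x)

end ClosedPoints

section AlgClosed

variable {K : Type u} [Field K] [IsAlgClosed K] {X : Scheme.{u}} (f : X ⟶ SpecOf K)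

lemma isReduced_of_smoothOfRelativeDimension_one [SmoothOfRelativeDimension 1 f] :
    IsReduced X := by
  have : Smooth f := SmoothOfRelativeDimension.smooth 1 f
  have : JacobsonSpace X := LocallyOfFiniteType.jacobsonSpace f
  refine isReduced_of_isReduced_stalk_of_isClosed fun x hx => ?_
  obtain ⟨_, -⟩ := exists_isDiscreteValuationRing_stalk (pointOfClosedPoint_comp f x hx)
  rw [← pointOfClosedPoint_apply f x hx (IsLocalRing.closedPoint K)]
  infer_instance

lemma constSection_top_surjective [IsIntegral X] [UniversallyClosed f] :
    Function.Surjective (constSection f ⊤) := by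
  have happ : (f.appLE ⊤ ⊤ le_top).hom.IsIntegral := by
    rw [show f.appLE ⊤ ⊤ le_top = f.appTop from f.appLE_eq_app]
    exact isIntegral_appTop_of_universallyClosed f
  have hconst : (constSection f ⊤).IsIntegral := RingHom.IsIntegral.trans _ _
    (RingHom.isIntegral_of_surjective _
      (Scheme.ΓSpecIso (CommRingCat.of K)).symm.commRingCatIsoToRingEquiv.surjective) happ
  exact (IsAlgClosed.ringHom_bijective_of_isIntegral _ hconst).2

lemma exists_constGerm_genericPoint_eq_of_isClosed [IsIntegral X] [UniversallyClosed f]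
    {g : X.functionField} (h : ∀ x : X, IsClosed {x} → ∃ w : X.presheaf.stalk x,
      algebraMap (X.presheaf.stalk x) X.functionField w = g) :
    ∃ c : K, constGerm f (genericPoint X) c = g := by
  have : CompactSpace X := (quasiCompact_iff_compactSpace f).mp inferInstance
  obtain ⟨a, rfl⟩ := exists_germ_genericPoint_eq_of_isClosed h
  obtain ⟨c, rfl⟩ := constSection_top_surjective f a
  exact ⟨c, (germ_constSection f ⊤ (genericPoint X) _ c).symm⟩

end AlgClosed

section AffineCoordinate

variable {k : Type u} [Field k] {X Y P : Scheme.{u}}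

lemma app_constSection (φ : X ⟶ Y) (g : Y ⟶ SpecOf k) (U : Y.Opens) (a : k) :
    φ.app U (constSection g U a) = constSection (φ ≫ g) (φ ⁻¹ᵁ U) a := by
  rw [Scheme.Hom.app_eq_appLE]
  exact congr($(Scheme.Hom.appLE_comp_appLE φ g ⊤ U (φ ⁻¹ᵁ U) le_top le_rfl) _)

lemma constSection_comp_specMap {K : Type u} [Field K] [Algebra k K] (f : X ⟶ SpecOf K)
    (U : X.Opens) (a : k) :
    constSection (f ≫ specMap k K) U a = constSection f U (algebraMap k K a) := by
  have hnat := congr($(Scheme.ΓSpecIso_inv_naturality (CommRingCat.ofHom (algebraMap k K))) a)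
  have happ := Scheme.Hom.appLE_comp_appLE f (specMap k K) ⊤ ⊤ U le_top le_top
  refine congr($happ.symm _).trans (congrArg (f.appLE ⊤ U le_top) (Eq.trans ?_ hnat.symm))
  rw [Scheme.Hom.appTop, Scheme.Hom.app_eq_appLE]
  rfl

/-- A function `t` on an open subset `U` of a `k`-scheme is an *affine coordinate* if `U` is affine
and its functions are the polynomials in `t` over `k`, that is, if `t : U ⟶ 𝔸¹` is a closed
immersion. -/
structure IsAffineCoordinate (q : P ⟶ SpecOf k) (U : P.Opens) (t : Γ(P, U)) : Prop where
  isAffineOpen : IsAffineOpen U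
  surjective : Function.Surjective (Polynomial.eval₂RingHom (constSection q U) t)

namespace IsAffineCoordinate

variable {q : P ⟶ SpecOf k} {U : P.Opens} {t : Γ(P, U)}

lemma ringHom_ext (h : IsAffineCoordinate q U t) {R : Type*} [Semiring R] {f g : Γ(P, U) →+* R}
    (hconst : ∀ a, f (constSection q U a) = g (constSection q U a)) (ht : f t = g t) : f = g := by
  refine (RingHom.cancel_right h.surjective).mp (Polynomial.ringHom_ext (fun a => ?_) ?_)
  · simpa using hconst a
  · simpa using ht

lemma maximalIdeal_stalk_eq_span (h : IsAffineCoordinate q U t) {s : SpecOf k ⟶ P}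
    (hs : s ≫ q = 𝟙 _) (hsU : s (IsLocalRing.closedPoint k) ∈ U) :
    IsLocalRing.maximalIdeal (P.presheaf.stalk (s (IsLocalRing.closedPoint k))) =
      Ideal.span {P.presheaf.germ U _ hsU t -
        constGerm q _ (evalAt s (P.presheaf.germ U _ hsU t))} := by
  set a := evalAt s (P.presheaf.germ U _ hsU t)
  let := TopCat.Presheaf.algebra_section_stalk P.presheaf ⟨_, hsU⟩
  have := h.isAffineOpen.isLocalization_stalk ⟨_, hsU⟩
  have heval : ((evalAt s).comp (P.presheaf.germ U _ hsU).hom).comp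
      (Polynomial.eval₂RingHom (constSection q U) t) = Polynomial.evalRingHom a := by
    refine Polynomial.ringHom_ext (fun b => ?_) ?_
    · simpa using (congrArg _ (germ_constSection q U _ hsU b)).trans (evalAt_constGerm hs b)
    · simp [a]
  have hprime : (h.isAffineOpen.primeIdealOf ⟨_, hsU⟩).asIdeal =
      Ideal.span {t - constSection q U a} := by
    have hker : (h.isAffineOpen.primeIdealOf ⟨_, hsU⟩).asIdeal =
        RingHom.ker ((evalAt s).comp (P.presheaf.germ U _ hsU).hom) := by
      ext y
      rw [h.isAffineOpen.primeIdealOf_eq_map_closedPoint]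
      exact (evalAt_eq_zero_iff s _).symm
    rw [hker, ← Ideal.map_comap_of_surjective _ h.surjective (RingHom.ker _), RingHom.comap_ker,
      heval, Polynomial.ker_evalRingHom, Ideal.map_span, Set.image_singleton]
    simp
  rw [← IsLocalization.AtPrime.map_eq_maximalIdeal (h.isAffineOpen.primeIdealOf ⟨_, hsU⟩).asIdeal
    (P.presheaf.stalk _), hprime, Ideal.map_span, Set.image_singleton, map_sub,
    ← germ_constSection q U _ hsU a]
  rfl

lemma section_ext (h : IsAffineCoordinate q U t) {s s' : SpecOf k ⟶ P} (hs : s ≫ q = 𝟙 _)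
    (hs' : s' ≫ q = 𝟙 _) (hsU : s (IsLocalRing.closedPoint k) ∈ U)
    (hsU' : s' (IsLocalRing.closedPoint k) ∈ U)
    (ht : evalAt s (P.presheaf.germ U _ hsU t) = evalAt s' (P.presheaf.germ U _ hsU' t)) :
    s = s' := by
  have hfac : ∀ (r : SpecOf k ⟶ P) (hr : r (IsLocalRing.closedPoint k) ∈ U),
      r = Spec.map (P.presheaf.germ U _ hr ≫ Scheme.stalkClosedPointTo r) ≫
        h.isAffineOpen.fromSpec := fun r hr => by
    conv_lhs => rw [← Scheme.Spec_stalkClosedPointTo_fromSpecStalk r,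
      ← h.isAffineOpen.fromSpecStalk_eq_fromSpecStalk hr]
    rw [IsAffineOpen.fromSpecStalk, Spec.map_comp, Category.assoc]
  have hcomp : (evalAt s).comp (P.presheaf.germ U _ hsU).hom =
      (evalAt s').comp (P.presheaf.germ U _ hsU').hom :=
    h.ringHom_ext (fun a => by
      simp only [RingHom.comp_apply]
      rw [germ_constSection, germ_constSection, evalAt_constGerm hs, evalAt_constGerm hs']) ht
  rw [hfac s hsU, hfac s' hsU']
  congr 2
  exact CommRingCat.hom_ext hcomp

end IsAffineCoordinate

section BaseChange

variable (K : Type u) [Field K] [Algebra k K] (q : P ⟶ SpecOf k)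

lemma subring_eq_top_of_isPushout {A B C R : CommRingCat.{u}} {f : A ⟶ B} {g : A ⟶ C} {i : B ⟶ R}
    {j : C ⟶ R} (h : IsPushout f g i j) (s : Subring R) (hi : ∀ b, i b ∈ s) (hj : ∀ c, j c ∈ s) :
    s = ⊤ := by
  let i' : B ⟶ CommRingCat.of s := CommRingCat.ofHom (i.hom.codRestrict s hi)
  let j' : C ⟶ CommRingCat.of s := CommRingCat.ofHom (j.hom.codRestrict s hj)
  have hw : f ≫ i' = g ≫ j' :=
    CommRingCat.hom_ext (RingHom.ext fun a => Subtype.ext congr($h.w a))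
  have hretract : h.desc i' j' hw ≫ CommRingCat.ofHom s.subtype = 𝟙 R := by
    refine h.hom_ext ?_ ?_
    · rw [h.inl_desc_assoc, Category.comp_id]; rfl
    · rw [h.inr_desc_assoc, Category.comp_id]; rfl
  refine eq_top_iff.mpr fun r _ => ?_
  have hr : s.subtype (h.desc i' j' hw r) = r := congr($hretract r)
  exact hr ▸ (h.desc i' j' hw r : s).2

lemma subring_baseChange_eq_top {U : P.Opens} (hU : IsAffineOpen U)
    (s : Subring Γ(baseChange K q, pullback.fst q (specMap k K) ⁻¹ᵁ U))
    (hsection : ∀ b : Γ(P, U), (pullback.fst q (specMap k K)).app U b ∈ s)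
    (hconst : ∀ a : K, constSection (pullback.snd q (specMap k K)) _ a ∈ s) : s = ⊤ := by
  have H := IsPullback.of_hasPullback q (specMap k K)
  have hiso := isIso_pushoutSection_of_isAffineOpen H (US := ⊤) (UT := ⊤) (UX := U)
    (UY := pullback.fst q (specMap k K) ⁻¹ᵁ U) le_top le_top (by simp)
    (isAffineOpen_top _) (isAffineOpen_top _) hU
  refine subring_eq_top_of_isPushout ((isIso_pushoutSection_iff H _ _ _).mp hiso) s
    (fun b => ?_) (fun c => ?_)
  · simpa [Scheme.Hom.appLE] using hsection b
  · have hc : (Scheme.ΓSpecIso (CommRingCat.of K)).inv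
        ((Scheme.ΓSpecIso (CommRingCat.of K)).hom c) = c := by simp
    have hmem := hconst ((Scheme.ΓSpecIso (CommRingCat.of K)).hom c)
    rw [constSection, CommRingCat.hom_comp, RingHom.comp_apply] at hmem
    exact hc ▸ hmem

lemma IsAffineCoordinate.baseChange {q : P ⟶ SpecOf k} {U : P.Opens} {t : Γ(P, U)}
    (h : IsAffineCoordinate q U t) :
    IsAffineCoordinate (pullback.snd q (specMap k K)) (pullback.fst q (specMap k K) ⁻¹ᵁ U)
      ((pullback.fst q (specMap k K)).app U t) where
  isAffineOpen := by
    have : IsAffineHom (pullback.fst q (specMap k K)) :=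
      MorphismProperty.IsStableUnderBaseChange.of_isPullback
        (IsPullback.of_hasPullback q (specMap k K)).flip inferInstance
    exact h.isAffineOpen.preimage _
  surjective := by
    refine RingHom.range_eq_top.mp (subring_baseChange_eq_top K q h.isAffineOpen _
      (fun b => ?_) fun a => ⟨Polynomial.C a, by simp⟩)
    obtain ⟨p, rfl⟩ := h.surjective b
    refine ⟨p.map (algebraMap k K), ?_⟩
    have hconst : (constSection (pullback.snd q (specMap k K)) _).comp (algebraMap k K) =
        ((pullback.fst q (specMap k K)).app U).hom.comp (constSection q U) := by
      ext a
      rw [RingHom.comp_apply, ← constSection_comp_specMap, RingHom.comp_apply,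
        app_constSection, pullback.condition]
    simp only [Polynomial.coe_eval₂RingHom, Polynomial.eval₂_map, Polynomial.hom_eval₂, hconst]

end BaseChange

end AffineCoordinate

section BinaryForms

open OnePoint MvPolynomial

lemma eval₂_mul_eq_pow_mul_eval₂ {σ R S : Type*} [CommSemiring R] [CommSemiring S]
    {F : MvPolynomial σ R} {n : ℕ} (hF : F.IsHomogeneous n) (f : R →+* S) (g : σ → S) (l : S) :
    F.eval₂ f (fun i => l * g i) = l ^ n * F.eval₂ f g := by
  rw [eval₂_eq, eval₂_eq, Finset.mul_sum]
  refine Finset.sum_congr rfl fun d hd => ?_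
  have hdeg : ∑ i ∈ d.support, d i = n := by
    simpa [Finsupp.weight_apply, Finsupp.sum] using hF (mem_support_iff.mp hd)
  rw [← hdeg, ← Finset.prod_pow_eq_pow_sum, mul_left_comm, ← Finset.prod_mul_distrib]
  simp only [mul_pow]

variable {K : Type*} [Field K]

/-- Homogeneous coordinates of a point of the projective line `K ∪ {∞}`. -/
def homCoord (c : OnePoint K) : Fin 2 → K := c.elim ![1, 0] fun a => ![a, 1]

/-- The linear form in two variables vanishing at a point of the projective line `K ∪ {∞}`. -/
def linearForm (c : OnePoint K) : MvPolynomial (Fin 2) K :=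
  C (homCoord c 1) * X 0 - C (homCoord c 0) * X 1

/-- The product of the linear forms vanishing at the points of a finite subset of the projective
line `K ∪ {∞}`. -/
def vanishingForm (S : Finset (OnePoint K)) : MvPolynomial (Fin 2) K := ∏ c ∈ S, linearForm c

lemma isHomogeneous_linearForm (c : OnePoint K) : (linearForm c).IsHomogeneous 1 :=
  ((isHomogeneous_X K 0).C_mul _).sub ((isHomogeneous_X K 1).C_mul _)

lemma eval_linearForm_eq_zero_iff {c d : OnePoint K} :
    eval (homCoord d) (linearForm c) = 0 ↔ d = c := by
  induction c using OnePoint.rec <;> induction d using OnePoint.rec <;>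
    simp [homCoord, linearForm, sub_eq_zero]

lemma isHomogeneous_vanishingForm (S : Finset (OnePoint K)) :
    (vanishingForm S).IsHomogeneous S.card := by
  simpa [vanishingForm] using IsHomogeneous.prod S _ _ fun c _ => isHomogeneous_linearForm c

lemma eval_vanishingForm_eq_zero_iff {S : Finset (OnePoint K)} {d : OnePoint K} :
    eval (homCoord d) (vanishingForm S) = 0 ↔ d ∈ S := by
  simp [vanishingForm, map_prod, Finset.prod_eq_zero_iff, eval_linearForm_eq_zero_iff]

lemma encard_zeros_le {H : MvPolynomial (Fin 2) K} {n : ℕ} (hH : H.IsHomogeneous n) (h0 : H ≠ 0) :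
    {d | eval (homCoord d) H = 0}.encard ≤ n + 1 := by
  classical
  set p : Polynomial K := aeval ![Polynomial.X, 1] H with hp
  have hp0 : p ≠ 0 := fun h => h0 <| by
    rw [← Polynomial.homogenize_eq_of_isHomogeneous hH hp.symm, h, Polynomial.homogenize_zero]
  have hdeg : p.natDegree ≤ n := by
    simpa using aeval_natDegree_le H hH.totalDegree_le _ (n := 1)
      (by simp [Fin.forall_fin_two])
  have heval (a : K) : eval (homCoord (a : OnePoint K)) H = p.eval a := by
    rw [hp, ← Polynomial.coe_evalRingHom, map_aeval]
    refine congr($(MvPolynomial.ringHom_ext (fun b => ?_) fun i => ?_) H)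
    · simp
    · fin_cases i <;> simp [homCoord]
  have hsub : {d | eval (homCoord d) H = 0} ⊆
      insert ∞ (((↑) : K → OnePoint K) '' p.roots.toFinset) := by
    intro d hd
    induction d using OnePoint.rec with
    | infty => exact Set.mem_insert _ _
    | coe a => exact Or.inr ⟨a, by simpa [hp0, heval] using hd, rfl⟩
  refine (Set.encard_le_encard hsub).trans ((Set.encard_insert_le _ _).trans ?_)
  gcongr
  refine (Set.encard_image_le _ _).trans ?_
  rw [Set.encard_coe_eq_coe_finsetCard]
  exact_mod_cast (Multiset.toFinset_card_le _).trans ((Polynomial.card_roots' p).trans hdeg)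

lemma encard_ratio_pow_fibre_le {F G : MvPolynomial (Fin 2) K} {n N : ℕ} (hF : F.IsHomogeneous n)
    (hG : G.IsHomogeneous n) {a : OnePoint K} (hFa : eval (homCoord a) F = 0)
    (hGa : eval (homCoord a) G ≠ 0) (hF0 : F ≠ 0) (hN : N ≠ 0) (r : K) :
    {d | (eval (homCoord d) F / eval (homCoord d) G) ^ N = r}.encard ≤
      ((n * N + n : ℕ) : ℕ∞) + 1 := by
  have hH : (F ^ N - C r * G ^ N) * G ≠ 0 := by
    refine mul_ne_zero (fun h => ?_) fun h => hGa (by simp [h])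
    have hr : r = 0 := by simpa [hFa, hGa, hN] using congrArg (eval (homCoord a)) h
    exact pow_ne_zero N hF0 (by simpa [hr] using h)
  refine (Set.encard_le_encard fun d hd => ?_).trans
    (encard_zeros_le (((hF.pow N).sub ((hG.pow N).C_mul r)).mul hG) hH)
  by_cases hd0 : eval (homCoord d) G = 0
  · simp [hd0]
  · rw [Set.mem_ofPred_eq, div_pow, div_eq_iff (pow_ne_zero N hd0)] at hd
    simp [hd]

/-- The function `F / G` on the projective line, where `F` and `G` are products of linear forms of
the same degree `S.card * S'.card` with set of zeros `S` and `S'`. For nonempty `S` it vanishes at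
the poles too, since division by zero gives zero. -/
def vanishingRatio (S S' : Finset (OnePoint K)) (d : OnePoint K) : K :=
  eval (homCoord d) (vanishingForm S ^ S'.card) / eval (homCoord d) (vanishingForm S' ^ S.card)

lemma vanishingRatio_ne_zero {S S' : Finset (OnePoint K)} {d : OnePoint K} (hd : d ∉ S)
    (hd' : d ∉ S') : vanishingRatio S S' d ≠ 0 := by
  simp only [vanishingRatio, map_pow]
  exact div_ne_zero (pow_ne_zero _ (eval_vanishingForm_eq_zero_iff.not.mpr hd))
    (pow_ne_zero _ (eval_vanishingForm_eq_zero_iff.not.mpr hd'))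

lemma vanishingRatio_eq_zero_of_mem_right {S S' : Finset (OnePoint K)} {d : OnePoint K}
    (hS : S.Nonempty) (hd : d ∈ S') : vanishingRatio S S' d = 0 := by
  rw [vanishingRatio, map_pow _ (vanishingForm S'), eval_vanishingForm_eq_zero_iff.mpr hd,
    zero_pow hS.card_ne_zero, div_zero]

lemma encard_vanishingRatio_pow_fibre_le {S S' : Finset (OnePoint K)} (hSS' : Disjoint S S')
    (hS : S.Nonempty) (hS' : S'.Nonempty) {N : ℕ} (hN : N ≠ 0) (r : K) :
    {d | vanishingRatio S S' d ^ N = r}.encard ≤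
      ((S.card * S'.card * N + S.card * S'.card : ℕ) : ℕ∞) + 1 := by
  obtain ⟨a, ha⟩ := hS
  obtain ⟨b, hb⟩ := hS'
  refine encard_ratio_pow_fibre_le ((isHomogeneous_vanishingForm S).pow _)
    (mul_comm S'.card S.card ▸ (isHomogeneous_vanishingForm S').pow _) (a := a) ?_ ?_ ?_ hN r
  · rw [map_pow, eval_vanishingForm_eq_zero_iff.mpr ha,
      zero_pow (Finset.card_ne_zero_of_mem hb)]
  · rw [map_pow]
    exact pow_ne_zero _ (eval_vanishingForm_eq_zero_iff.not.mpr (Finset.disjoint_left.mp hSS' ha))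
  · refine pow_ne_zero _ fun h => Finset.disjoint_right.mp hSS' hb ?_
    rw [← eval_vanishingForm_eq_zero_iff, h, map_zero]

end BinaryForms

/-- A *projective coordinate* on a scheme `X` describes a morphism `[X₀ : X₁]` from `X` to the
projective line: `U i` is the open subset where `X i` is invertible, and `coord i` is the function
`X j / X i` on it, where `j = i.rev` is the other index. -/
structure ProjectiveCoordinate (X : Scheme.{u}) where
  U : Fin 2 → X.Opens
  coord : ∀ i, Γ(X, U i)
  exists_mem : ∀ x, ∃ i, x ∈ U i
  germ_mul_germ : ∀ x (h₀ : x ∈ U 0) (h₁ : x ∈ U 1),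
    X.presheaf.germ (U 0) x h₀ (coord 0) * X.presheaf.germ (U 1) x h₁ (coord 1) = 1
  mem_of_isUnit : ∀ i x (h : x ∈ U i), IsUnit (X.presheaf.germ (U i) x h (coord i)) → x ∈ U i.rev

namespace ProjectiveCoordinate

variable {X Y : Scheme.{u}}

/-- The composition of a projective coordinate with a morphism. -/
def pullback (C : ProjectiveCoordinate Y) (φ : X ⟶ Y) : ProjectiveCoordinate X where
  U i := φ ⁻¹ᵁ C.U i
  coord i := φ.app (C.U i) (C.coord i)
  exists_mem x := C.exists_mem (φ x)
  germ_mul_germ x h₀ h₁ := by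
    have h := congrArg (φ.stalkMap x) (C.germ_mul_germ _ h₀ h₁)
    rw [map_mul, map_one] at h
    refine Eq.trans (congrArg₂ (· * ·) ?_ ?_) h <;>
      exact (Scheme.Hom.germ_stalkMap_apply _ _ _ _ _).symm
  mem_of_isUnit i x h hu := by
    have hgerm := Scheme.Hom.germ_stalkMap_apply φ (C.U i) x h (C.coord i)
    exact C.mem_of_isUnit i _ h (isUnit_of_map_unit (φ.stalkMap x).hom _ (hgerm ▸ hu))

lemma mem_zero (C : ProjectiveCoordinate X) {x : X} (h : x ∉ C.U 1) : x ∈ C.U 0 := by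
  simpa [h, Fin.exists_fin_two] using C.exists_mem x

open Classical in
/-- Homogeneous coordinates of `X ⟶ ℙ¹` near the point `x`: one of the two coordinates is
normalised to `1`. -/
def homogeneousCoord (C : ProjectiveCoordinate X) (x : X) : Fin 2 → X.presheaf.stalk x :=
  if h : x ∈ C.U 1 then ![X.presheaf.germ (C.U 1) x h (C.coord 1), 1]
  else ![1, X.presheaf.germ (C.U 0) x (C.mem_zero h) (C.coord 0)]

lemma stalkMap_homogeneousCoord (C : ProjectiveCoordinate Y) (φ : X ⟶ Y) (x : X) (i : Fin 2) :
    φ.stalkMap x (C.homogeneousCoord (φ x) i) = (C.pullback φ).homogeneousCoord x i := by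
  have hmem : x ∈ (C.pullback φ).U 1 ↔ φ x ∈ C.U 1 := Iff.rfl
  by_cases h : φ x ∈ C.U 1 <;> fin_cases i <;> simp only [homogeneousCoord, h, hmem] <;>
    simp [Scheme.Hom.germ_stalkMap_apply] <;> rfl

lemma exists_stalkSpecializes_homogeneousCoord (C : ProjectiveCoordinate X) {x y : X} (h : x ⤳ y) :
    ∃ l : (X.presheaf.stalk x)ˣ, ∀ i,
      X.presheaf.stalkSpecializes h (C.homogeneousCoord y i) = l * C.homogeneousCoord x i := by
  have hgerm (i : Fin 2) (hy : y ∈ C.U i) :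
      X.presheaf.stalkSpecializes h (X.presheaf.germ (C.U i) y hy (C.coord i)) =
        X.presheaf.germ (C.U i) x (h.mem_open (C.U i).2 hy) (C.coord i) :=
    X.presheaf.germ_stalkSpecializes_apply _ _ _
  by_cases hy : y ∈ C.U 1
  · have hx : x ∈ C.U 1 := h.mem_open (C.U 1).2 hy
    exact ⟨1, fun i => by fin_cases i <;> simp [homogeneousCoord, hx, hy, hgerm]⟩
  · have hx₀ : x ∈ C.U 0 := h.mem_open (C.U 0).2 (C.mem_zero hy)
    by_cases hx : x ∈ C.U 1
    · refine ⟨Units.mkOfMulEqOne _ _ (C.germ_mul_germ x hx₀ hx), fun i => ?_⟩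
      fin_cases i <;> simp [homogeneousCoord, hx, hy, hgerm, C.germ_mul_germ x hx₀ hx]
    · exact ⟨1, fun i => by fin_cases i <;> simp [homogeneousCoord, hx, hy, hgerm]⟩

section Value

variable {K : Type u} [Field K] (C : ProjectiveCoordinate X)

open Classical in
/-- The value of a projective coordinate at a rational point. -/
def value (s : SpecOf K ⟶ X) : OnePoint K :=
  if h : s (IsLocalRing.closedPoint K) ∈ C.U 1 then
    (evalAt s (X.presheaf.germ (C.U 1) _ h (C.coord 1)) : K) else OnePoint.infty

lemma evalAt_homogeneousCoord (s : SpecOf K ⟶ X) (i : Fin 2) :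
    evalAt s (C.homogeneousCoord _ i) = homCoord (C.value s) i := by
  by_cases h : s (IsLocalRing.closedPoint K) ∈ C.U 1
  · fin_cases i <;> simp [homogeneousCoord, value, homCoord, h]
  · have h0 : evalAt s (X.presheaf.germ (C.U 0) _ (C.mem_zero h) (C.coord 0)) = 0 :=
      (evalAt_eq_zero_iff s _).mpr fun hu => h (C.mem_of_isUnit 0 _ _ hu)
    fin_cases i <;> simp [homogeneousCoord, value, homCoord, h, h0]

lemma value_comp (C : ProjectiveCoordinate Y) (φ : X ⟶ Y) (s : SpecOf K ⟶ X) :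
    C.value (s ≫ φ) = (C.pullback φ).value s := by
  by_cases h : (s ≫ φ) (IsLocalRing.closedPoint K) ∈ C.U 1
  · have h' : s (IsLocalRing.closedPoint K) ∈ (C.pullback φ).U 1 := h
    rw [value, dif_pos h, value, dif_pos h']
    exact congrArg _ ((evalAt_comp s φ _).trans
      (congrArg (evalAt s) (Scheme.Hom.germ_stalkMap_apply φ _ _ h _)))
  · have h' : s (IsLocalRing.closedPoint K) ∉ (C.pullback φ).U 1 := h
    rw [value, dif_neg h, value, dif_neg h']

/-- A projective coordinate is an *embedding* of the `K`-scheme `X` if both of its affine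
coordinates are, that is, if the corresponding morphism `X ⟶ ℙ¹` is a closed immersion. -/
def IsEmbedding (q : X ⟶ SpecOf K) : Prop := ∀ i, IsAffineCoordinate q (C.U i) (C.coord i)

variable {C} in
lemma IsEmbedding.baseChange {k : Type u} [Field k] [Algebra k K] {q : X ⟶ SpecOf k}
    (h : C.IsEmbedding q) :
    (C.pullback (pullback.fst q (specMap k K))).IsEmbedding (pullback.snd q (specMap k K)) :=
  fun i => (h i).baseChange K

variable {C} in
lemma IsEmbedding.value_injective {q : X ⟶ SpecOf K} (hC : C.IsEmbedding q)
    {s s' : SpecOf K ⟶ X} (hs : s ≫ q = 𝟙 _) (hs' : s' ≫ q = 𝟙 _)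
    (h : C.value s = C.value s') : s = s' := by
  by_cases h₁ : s (IsLocalRing.closedPoint K) ∈ C.U 1 <;>
    by_cases h₁' : s' (IsLocalRing.closedPoint K) ∈ C.U 1
  · rw [value, value, dif_pos h₁, dif_pos h₁', OnePoint.coe_eq_coe] at h
    exact (hC 1).section_ext hs hs' h₁ h₁' h
  · simp [value, h₁, h₁'] at h
  · simp [value, h₁, h₁'] at h
  · have hval := congrFun (congrArg homCoord h) 1
    rw [← C.evalAt_homogeneousCoord, ← C.evalAt_homogeneousCoord] at hval
    simp only [homogeneousCoord, dif_neg h₁, dif_neg h₁'] at hval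
    exact (hC 0).section_ext hs hs' (C.mem_zero h₁) (C.mem_zero h₁') hval

end Value

section FormAt

open MvPolynomial

variable {K : Type u} [Field K] (C : ProjectiveCoordinate X)

/-- The germ at `x` of a binary form, evaluated at the homogeneous coordinates of
`X ⟶ ℙ¹` near `x`. -/
def formAt (f : X ⟶ SpecOf K) (F : MvPolynomial (Fin 2) K) (x : X) : X.presheaf.stalk x :=
  F.eval₂ (constGerm f x) (C.homogeneousCoord x)

lemma stalkMap_formAt (C : ProjectiveCoordinate Y) {f : X ⟶ SpecOf K} {g : Y ⟶ SpecOf K}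
    (φ : X ⟶ Y) (h : φ ≫ g = f) (F : MvPolynomial (Fin 2) K) (x : X) :
    φ.stalkMap x (C.formAt g F (φ x)) = (C.pullback φ).formAt f F x := by
  refine (eval₂_comp_left (φ.stalkMap x).hom _ _ F).trans ?_
  refine congrArg₂ (fun a b => F.eval₂ a b) (RingHom.ext fun a => ?_) (funext fun i => ?_)
  · exact stalkMap_constGerm φ h x a
  · exact C.stalkMap_homogeneousCoord φ x i

lemma evalAt_formAt {f : X ⟶ SpecOf K} {s : SpecOf K ⟶ X} (hs : s ≫ f = 𝟙 _)
    (F : MvPolynomial (Fin 2) K) :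
    evalAt s (C.formAt f F _) = eval (homCoord (C.value s)) F := by
  refine (eval₂_comp_left (evalAt s) _ _ F).trans ?_
  refine congrArg₂ (fun a b => F.eval₂ a b) (RingHom.ext fun a => ?_) (funext fun i => ?_)
  · exact evalAt_constGerm hs a
  · exact C.evalAt_homogeneousCoord s i

lemma isUnit_formAt_iff {f : X ⟶ SpecOf K} {s : SpecOf K ⟶ X} (hs : s ≫ f = 𝟙 _)
    {F : MvPolynomial (Fin 2) K} : IsUnit (C.formAt f F (s (IsLocalRing.closedPoint K))) ↔
      eval (homCoord (C.value s)) F ≠ 0 := by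
  rw [← C.evalAt_formAt hs, Ne, evalAt_eq_zero_iff, IsLocalRing.mem_maximalIdeal, mem_nonunits_iff,
    not_not]

lemma exists_stalkSpecializes_formAt (f : X ⟶ SpecOf K) {x y : X} (h : x ⤳ y) :
    ∃ l : (X.presheaf.stalk x)ˣ, ∀ (F : MvPolynomial (Fin 2) K) (n : ℕ), F.IsHomogeneous n →
      X.presheaf.stalkSpecializes h (C.formAt f F y) = l ^ n * C.formAt f F x := by
  obtain ⟨l, hl⟩ := C.exists_stalkSpecializes_homogeneousCoord h
  refine ⟨l, fun F n hF => ?_⟩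
  refine (eval₂_comp_left (X.presheaf.stalkSpecializes h).hom _ _ F).trans ?_
  rw [formAt, ← eval₂_mul_eq_pow_mul_eval₂ hF]
  refine congrArg₂ (fun a b => F.eval₂ a b) (RingHom.ext fun a => ?_) (funext hl)
  exact stalkSpecializes_constGerm f h a

variable {C} in
lemma IsEmbedding.maximalIdeal_stalk_eq_span {q : X ⟶ SpecOf K} (hC : C.IsEmbedding q)
    {s : SpecOf K ⟶ X} (hs : s ≫ q = 𝟙 _) :
    IsLocalRing.maximalIdeal (X.presheaf.stalk (s (IsLocalRing.closedPoint K))) =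
      Ideal.span {C.formAt q (linearForm (C.value s)) _} := by
  by_cases h : s (IsLocalRing.closedPoint K) ∈ C.U 1
  · rw [(hC 1).maximalIdeal_stalk_eq_span hs h]
    simp [formAt, linearForm, homCoord, value, homogeneousCoord, h]
  · have h0 := C.evalAt_homogeneousCoord s 1
    simp only [homogeneousCoord, value, dif_neg h] at h0
    rw [(hC 0).maximalIdeal_stalk_eq_span hs (C.mem_zero h)]
    simp_all [formAt, linearForm, homCoord, value, homogeneousCoord, Ideal.span_singleton_neg]

end FormAt

end ProjectiveCoordinate

section StandardCoordinate

variable {k : Type u} [Field k]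

attribute [local instance] MvPolynomial.gradedAlgebra

lemma constSection_eq_of_ι_comp {P : Scheme.{u}} {q : P ⟶ SpecOf k} {U : P.Opens}
    (ψ : CommRingCat.of k ⟶ Γ(P, U)) (h : U.ι ≫ q = U.toSpecΓ ≫ Spec.map ψ) (a : k) :
    constSection q U a = ψ a := by
  have htop := congr(Scheme.Hom.appTop $h)
  rw [Scheme.Hom.comp_appTop, Scheme.Hom.comp_appTop, Scheme.Opens.toSpecΓ_appTop,
    Scheme.ΓSpecIso_naturality_assoc, ← Iso.inv_comp_eq] at htop
  have hψ : (Scheme.ΓSpecIso (CommRingCat.of k)).inv ≫ q.appTop ≫ U.ι.appTop ≫ U.topIso.hom =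
      ψ := by
    rw [← Category.assoc, ← Category.assoc, Category.assoc _ q.appTop, htop]
    simp only [Category.assoc, Iso.inv_hom_id, Category.comp_id]
  have hres : U.ι.appTop ≫ U.topIso.hom = P.presheaf.map (homOfLE le_top).op := by
    rw [Scheme.Hom.appTop, Scheme.Opens.ι_app]
    exact (P.presheaf.map_comp _ _).symm
  rw [hres] at hψ
  exact congr($hψ a)

/-- The grading of the homogeneous coordinate ring of the projective line. -/
abbrev grading (k : Type u) [Field k] : ℕ → Submodule k (MvPolynomial (Fin 2) k) :=
  MvPolynomial.homogeneousSubmodule (Fin 2) k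

lemma X_mem_grading (i : Fin 2) : (MvPolynomial.X i : MvPolynomial (Fin 2) k) ∈ grading k 1 :=
  MvPolynomial.isHomogeneous_X k i

lemma algebraMap_grading_zero_surjective : Function.Surjective (algebraMap k (grading k 0)) :=
  fun ⟨_, hp⟩ => ⟨_, Subtype.ext (MvPolynomial.totalDegree_eq_zero_iff_eq_C.mp
    (Nat.le_zero.mp (MvPolynomial.IsHomogeneous.totalDegree_le hp))).symm⟩

lemma adjoin_grading_zero_range_X :
    Algebra.adjoin (grading k 0) (Set.range (MvPolynomial.X : Fin 2 → MvPolynomial (Fin 2) k)) =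
      ⊤ := by
  rw [eq_top_iff]
  rintro p -
  induction p using MvPolynomial.induction_on with
  | C a => exact Subalgebra.algebraMap_mem _ (algebraMap k (grading k 0) a)
  | add p q hp hq => exact add_mem (hp) (hq)
  | mul_X p j hp => exact mul_mem (hp) (Algebra.subset_adjoin ⟨j, rfl⟩)

/-- The ring of functions on the standard affine open subset `X i ≠ 0` of the projective line. -/
abbrev AwayX (k : Type u) [Field k] (i : Fin 2) : Type u :=
  HomogeneousLocalization.Away (grading k) (MvPolynomial.X i : MvPolynomial (Fin 2) k)

/-- The affine coordinate `X j / X i` on the standard open subset `X i ≠ 0` of the projective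
line, where `j = i.rev` is the other index. -/
def awayCoord (k : Type u) [Field k] (i : Fin 2) : AwayX k i :=
  HomogeneousLocalization.Away.mk (grading k) (X_mem_grading i) 1 (MvPolynomial.X i.rev)
    (X_mem_grading i.rev)

/-- The inclusion of the constants into the functions on the standard open subset `X i ≠ 0`. -/
def awayConst (k : Type u) [Field k] (i : Fin 2) : k →+* AwayX k i :=
  (HomogeneousLocalization.fromZeroRingHom (grading k) _).comp (algebraMap k (grading k 0))

lemma awayMk_prod_X_pow (i : Fin 2) {a : ℕ} (e : Fin 2 → ℕ) (he : ∑ j, e j = a)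
    (hmem : ∏ j, (MvPolynomial.X j : MvPolynomial (Fin 2) k) ^ e j ∈ grading k (a • 1)) :
    HomogeneousLocalization.Away.mk (grading k) (X_mem_grading i) a (∏ j, MvPolynomial.X j ^ e j)
      hmem = awayCoord k i ^ e i.rev := by
  apply HomogeneousLocalization.val_injective
  rw [HomogeneousLocalization.Away.val_mk, HomogeneousLocalization.val_pow, awayCoord,
    HomogeneousLocalization.Away.val_mk, Localization.mk_pow, Localization.mk_eq_mk_iff,
    Localization.r_iff_exists]
  refine ⟨1, ?_⟩
  subst he
  fin_cases i <;> simp [Fin.sum_univ_two, Fin.prod_univ_two] <;> ring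

lemma eval₂_awayCoord_surjective (i : Fin 2) :
    Function.Surjective (Polynomial.eval₂RingHom (awayConst k i) (awayCoord k i)) := by
  let B : Subalgebra (grading k 0) (AwayX k i) :=
    { (Polynomial.eval₂RingHom (awayConst k i) (awayCoord k i)).range with
      algebraMap_mem' := fun a => by
        obtain ⟨a, rfl⟩ := algebraMap_grading_zero_surjective a
        exact ⟨Polynomial.C a, Polynomial.eval₂_C _ _⟩ }
  have hcoord : awayCoord k i ∈ B := ⟨Polynomial.X, Polynomial.eval₂_X _ _⟩
  have hadjoin := HomogeneousLocalization.Away.adjoin_mk_prod_pow_eq_top (𝒜 := grading k)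
    (X_mem_grading i) (Fin 2) MvPolynomial.X adjoin_grading_zero_range_X (fun _ => 1) X_mem_grading
  have hB : B = ⊤ := by
    rw [← top_le_iff, ← hadjoin, Algebra.adjoin_le_iff]
    rintro _ ⟨a, e, he, -, rfl⟩
    rw [SetLike.mem_coe, awayMk_prod_X_pow i e (by simpa using he)]
    exact pow_mem hcoord _
  exact fun y => (hB ▸ Algebra.mem_top : y ∈ B)

lemma constSection_projectiveLineToSpec (i : Fin 2) (a : k) :
    constSection (projectiveLineToSpec k) (Proj.basicOpen (grading k) (MvPolynomial.X i)) a =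
      Proj.awayToSection (grading k) (MvPolynomial.X i) (awayConst k i a) := by
  refine constSection_eq_of_ι_comp (CommRingCat.ofHom (algebraMap k (grading k 0)) ≫
    CommRingCat.ofHom (HomogeneousLocalization.fromZeroRingHom (grading k) _) ≫
    Proj.awayToSection (grading k) (MvPolynomial.X i)) ?_ a
  have h := Proj.awayι_toSpecZero (grading k) (MvPolynomial.X i : MvPolynomial (Fin 2) k)
    (X_mem_grading i) one_pos
  rw [Proj.awayι, Category.assoc, Iso.inv_comp_eq] at h
  rw [projectiveLineToSpec, Spec.map_comp, Spec.map_comp, ← Category.assoc, ← Category.assoc,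
    ← Category.assoc]
  exact congrArg (· ≫ _) h

lemma stalkIso_germ_awayCoord (i : Fin 2) (p : projectiveLine k)
    (hp : p ∈ Proj.basicOpen (grading k) (MvPolynomial.X i)) :
    ((Proj.stalkIso (grading k) p).hom ((projectiveLine k).presheaf.germ _ p hp
      (Proj.awayToSection (grading k) (MvPolynomial.X i) (awayCoord k i)))).val =
      Localization.mk (MvPolynomial.X i.rev) ⟨MvPolynomial.X i, hp⟩ := by
  have hgerm := congr($(ProjectiveSpectrum.Proj.awayToSection_germ (grading k) (MvPolynomial.X i)
    p hp) (awayCoord k i))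
  have hstalk : (Proj.stalkIso (grading k) p).hom ((projectiveLine k).presheaf.germ _ p hp
      (Proj.awayToSection (grading k) (MvPolynomial.X i) (awayCoord k i))) =
      HomogeneousLocalization.mapId (grading k) (Submonoid.powers_le.mpr hp) (awayCoord k i) :=
    (congrArg (Proj.stalkIso (grading k) p).hom hgerm).trans
      ((Proj.stalkIso (grading k) p).commRingCatIsoToRingEquiv.apply_symm_apply _)
  rw [hstalk]
  simp only [awayCoord, HomogeneousLocalization.mapId, HomogeneousLocalization.Away.mk, pow_one]
  rfl

/-- The standard projective coordinate of the projective line. -/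
def standardCoordinate (k : Type u) [Field k] : ProjectiveCoordinate (projectiveLine k) where
  U i := Proj.basicOpen (grading k) (MvPolynomial.X i)
  coord i := Proj.awayToSection (grading k) (MvPolynomial.X i) (awayCoord k i)
  exists_mem p := by
    have hcover := Proj.iSup_basicOpen_eq_top' (grading k) (MvPolynomial.X : Fin 2 → _)
      (fun i => ⟨1, X_mem_grading i⟩) adjoin_grading_zero_range_X
    exact TopologicalSpace.Opens.mem_iSup.mp
      (hcover ▸ trivial : p ∈ ⨆ i, Proj.basicOpen (grading k) (MvPolynomial.X i))
  germ_mul_germ p h₀ h₁ := by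
    apply (Proj.stalkIso (grading k) p).commRingCatIsoToRingEquiv.injective
    apply HomogeneousLocalization.val_injective
    rw [map_mul, map_one, HomogeneousLocalization.val_mul, HomogeneousLocalization.val_one]
    refine (congrArg₂ (· * ·) (stalkIso_germ_awayCoord 0 p h₀)
      (stalkIso_germ_awayCoord 1 p h₁)).trans ?_
    simp only [Localization.mk_mul]
    rw [← Localization.mk_one, Localization.mk_eq_mk_iff, Localization.r_iff_exists]
    exact ⟨1, by simp [mul_comm]⟩
  mem_of_isUnit i p h hu := by
    have : p.asHomogeneousIdeal.toIdeal.IsPrime := ProjectiveSpectrum.isPrime p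
    have hunit := (hu.map (Proj.stalkIso (grading k) p).hom.hom).map
      (algebraMap _ (Localization.AtPrime p.asHomogeneousIdeal.toIdeal))
    have hmk : IsUnit (Localization.mk (MvPolynomial.X i.rev) ⟨MvPolynomial.X i, h⟩ :
        Localization.AtPrime p.asHomogeneousIdeal.toIdeal) := stalkIso_germ_awayCoord i p h ▸ hunit
    rwa [Localization.mk_eq_mk', IsLocalization.AtPrime.isUnit_mk'_iff
      (Localization.AtPrime p.asHomogeneousIdeal.toIdeal) p.asHomogeneousIdeal.toIdeal] at hmk

lemma isEmbedding_standardCoordinate :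
    (standardCoordinate k).IsEmbedding (projectiveLineToSpec k) := fun i =>
  { isAffineOpen := Proj.isAffineOpen_basicOpen _ _ (X_mem_grading i) one_pos
    surjective := fun y => by
      obtain ⟨w, rfl⟩ := (Proj.basicOpenIsoAway (grading k) (MvPolynomial.X i)
        (X_mem_grading i) one_pos).commRingCatIsoToRingEquiv.surjective y
      obtain ⟨p, rfl⟩ := eval₂_awayCoord_surjective i w
      refine ⟨p, ?_⟩
      have hconst : constSection (projectiveLineToSpec k)
          (Proj.basicOpen (grading k) (MvPolynomial.X i)) =
          (Proj.awayToSection (grading k) (MvPolynomial.X i)).hom.comp (awayConst k i) :=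
        RingHom.ext (constSection_projectiveLineToSpec i)
      exact (congrArg (fun f => p.eval₂ f _) hconst).trans (Polynomial.hom_eval₂ _ _ _ _).symm }

end StandardCoordinate

namespace ProjectiveCoordinate

open MvPolynomial

section Ramification

variable {K : Type u} [Field K] {X P : Scheme.{u}} {q : P ⟶ SpecOf K} {C : ProjectiveCoordinate P}
  {f : X ⟶ SpecOf K} {s : SpecOf K ⟶ X}

lemma associated_formAt_vanishingForm_linearForm (B : ProjectiveCoordinate X) (hs : s ≫ f = 𝟙 _)
    {S : Finset (OnePoint K)} (hS : B.value s ∈ S) :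
    Associated (B.formAt f (vanishingForm S) (s (IsLocalRing.closedPoint K)))
      (B.formAt f (linearForm (B.value s)) _) := by
  classical
  rw [vanishingForm, ← Finset.mul_prod_erase S _ hS, formAt, eval₂_mul]
  refine associated_mul_unit_left _ _ ((B.isUnit_formAt_iff hs).mpr ?_)
  simpa [eval_prod, Finset.prod_ne_zero_iff, eval_linearForm_eq_zero_iff] using
    fun c hc _ h => hc h.symm

lemma IsEmbedding.map_maximalIdeal_stalk_eq_span (hC : C.IsEmbedding q) {φ : X ⟶ P}
    (hφ : φ ≫ q = f) (hs : s ≫ f = 𝟙 _) {S : Finset (OnePoint K)} (hS : C.value (s ≫ φ) ∈ S) :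
    (IsLocalRing.maximalIdeal (P.presheaf.stalk (φ (s (IsLocalRing.closedPoint K))))).map
        (φ.stalkMap _).hom = Ideal.span {(C.pullback φ).formAt f (vanishingForm S) _} := by
  rw [C.value_comp] at hS
  have hmax := hC.maximalIdeal_stalk_eq_span (s := s ≫ φ) (by rw [Category.assoc, hφ, hs])
  rw [C.value_comp] at hmax
  refine (congrArg (Ideal.map (φ.stalkMap _).hom) hmax).trans <|
    (Ideal.map_span _ _).trans <| (congrArg Ideal.span Set.image_singleton).trans ?_
  refine (congrArg (fun a => Ideal.span {a}) (C.stalkMap_formAt φ hφ _ _)).trans ?_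
  obtain ⟨v, hv⟩ := associated_formAt_vanishingForm_linearForm (C.pullback φ) hs hS
  rw [← hv, Ideal.span_singleton_mul_right_unit v.isUnit]

variable [SmoothOfRelativeDimension 1 f]

lemma IsEmbedding.span_formAt_vanishingForm (hC : C.IsEmbedding q) {φ : X ⟶ P}
    (hφ : φ ≫ q = f) (hs : s ≫ f = 𝟙 _) {S : Finset (OnePoint K)} (hS : C.value (s ≫ φ) ∈ S)
    (h0 : (C.pullback φ).formAt f (vanishingForm S) (s (IsLocalRing.closedPoint K)) ≠ 0) :
    Ideal.span {(C.pullback φ).formAt f (vanishingForm S) (s (IsLocalRing.closedPoint K))} =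
      IsLocalRing.maximalIdeal _ ^ ramificationIndexAt φ (s (IsLocalRing.closedPoint K)) := by
  obtain ⟨_, _⟩ := exists_isDiscreteValuationRing_stalk hs
  have hmap := hC.map_maximalIdeal_stalk_eq_span hφ hs hS
  rw [← hmap]
  let := (φ.stalkMap (s (IsLocalRing.closedPoint K))).hom.toAlgebra
  refine map_eq_maximalIdeal_pow_ramificationIdx' fun hbot => h0 ?_
  exact Ideal.span_singleton_eq_bot.mp (hmap.symm.trans hbot)

lemma IsEmbedding.associated_formAt_vanishingForm (hC : C.IsEmbedding q) {φ ψ : X ⟶ P}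
    (hφ : φ ≫ q = f) (hψ : ψ ≫ q = f) (hs : s ≫ f = 𝟙 _) {S : Finset (OnePoint K)}
    (hφ0 : (C.pullback φ).formAt f (vanishingForm S) (s (IsLocalRing.closedPoint K)) ≠ 0)
    (hψ0 : (C.pullback ψ).formAt f (vanishingForm S) (s (IsLocalRing.closedPoint K)) ≠ 0)
    (hS : C.value (s ≫ φ) ∈ S ↔ C.value (s ≫ ψ) ∈ S)
    (he : C.value (s ≫ φ) ∈ S → ramificationIndexAt φ (s (IsLocalRing.closedPoint K)) =
      ramificationIndexAt ψ (s (IsLocalRing.closedPoint K))) :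
    Associated ((C.pullback φ).formAt f (vanishingForm S) (s (IsLocalRing.closedPoint K)))
      ((C.pullback ψ).formAt f (vanishingForm S) (s (IsLocalRing.closedPoint K))) := by
  by_cases h : C.value (s ≫ φ) ∈ S
  · obtain ⟨_, _⟩ := exists_isDiscreteValuationRing_stalk hs
    rw [← Ideal.span_singleton_eq_span_singleton, hC.span_formAt_vanishingForm hφ hs h hφ0,
      hC.span_formAt_vanishingForm hψ hs (hS.mp h) hψ0, he h]
  · have isUnit_formAt {χ : X ⟶ P} (hχ : C.value (s ≫ χ) ∉ S) :
        IsUnit ((C.pullback χ).formAt f (vanishingForm S) (s (IsLocalRing.closedPoint K))) := by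
      rwa [isUnit_formAt_iff _ hs, Ne, eval_vanishingForm_eq_zero_iff, ← C.value_comp]
    exact (associated_one_iff_isUnit.mpr (isUnit_formAt h)).trans
      (associated_one_iff_isUnit.mpr (isUnit_formAt (hS.not.mp h))).symm

end Ramification

section FunctionField

variable {K : Type u} [Field K] {E : Scheme.{u}} [IsIntegral E] (A B : ProjectiveCoordinate E)
  (f : E ⟶ SpecOf K)

lemma exists_algebraMap_formAt (x : E) :
    ∃ l : E.functionFieldˣ, ∀ (F : MvPolynomial (Fin 2) K) (n : ℕ), F.IsHomogeneous n →
      algebraMap (E.presheaf.stalk x) E.functionField (A.formAt f F x) =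
        l ^ n * A.formAt f F (genericPoint E) :=
  A.exists_stalkSpecializes_formAt f ((genericPoint_spec E).specializes trivial)

lemma formAt_eq_zero_iff_genericPoint {F : MvPolynomial (Fin 2) K} {n : ℕ}
    (hF : F.IsHomogeneous n) (x : E) :
    A.formAt f F x = 0 ↔ A.formAt f F (genericPoint E) = 0 := by
  obtain ⟨l, hl⟩ := A.exists_algebraMap_formAt f x
  rw [← map_eq_zero_iff _ (IsFractionRing.injective (E.presheaf.stalk x) E.functionField),
    hl F n hF, ← Units.val_pow_eq_pow_val, Units.mul_right_eq_zero]

lemma formAt_ne_zero {F : MvPolynomial (Fin 2) K} {n : ℕ} (hF : F.IsHomogeneous n)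
    {s : SpecOf K ⟶ E} (hs : s ≫ f = 𝟙 _) (h : eval (homCoord (A.value s)) F ≠ 0) (x : E) :
    A.formAt f F x ≠ 0 := by
  rw [Ne, A.formAt_eq_zero_iff_genericPoint f hF, ← A.formAt_eq_zero_iff_genericPoint f hF]
  exact ((A.isUnit_formAt_iff hs).mpr h).ne_zero

lemma exists_algebraMap_formAt_mul_formAt (x : E) :
    ∃ l : E.functionFieldˣ, ∀ (F G : MvPolynomial (Fin 2) K) (n : ℕ),
      F.IsHomogeneous n → G.IsHomogeneous n →
      algebraMap (E.presheaf.stalk x) E.functionField (A.formAt f F x * B.formAt f G x) =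
        l ^ n * (A.formAt f F (genericPoint E) * B.formAt f G (genericPoint E)) := by
  obtain ⟨l, hl⟩ := A.exists_algebraMap_formAt f x
  obtain ⟨m, hm⟩ := B.exists_algebraMap_formAt f x
  refine ⟨l * m, fun F G n hF hG => ?_⟩
  rw [map_mul, hl F n hF, hm G n hG, Units.val_mul, mul_pow, mul_mul_mul_comm]

/-- The rational functions `F(A) / G(A)` and `F(B) / G(B)` have the same divisor, so that their
quotient is constant. -/
lemma exists_formAt_mul_formAt_eq [IsAlgClosed K] [UniversallyClosed f]
    {F G : MvPolynomial (Fin 2) K} {n : ℕ} (hF : F.IsHomogeneous n) (hG : G.IsHomogeneous n)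
    (hA : A.formAt f G (genericPoint E) ≠ 0) (hB : B.formAt f F (genericPoint E) ≠ 0)
    (hFx : ∀ x, IsClosed {x} → Associated (A.formAt f F x) (B.formAt f F x))
    (hGx : ∀ x, IsClosed {x} → Associated (A.formAt f G x) (B.formAt f G x)) :
    ∃ c : K, ∀ x, A.formAt f F x * B.formAt f G x =
      constGerm f x c * (A.formAt f G x * B.formAt f F x) := by
  have hden := mul_ne_zero hA hB
  obtain ⟨c, hc⟩ := exists_constGerm_genericPoint_eq_of_isClosed f
    (g := A.formAt f F (genericPoint E) * B.formAt f G (genericPoint E) /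
      (A.formAt f G (genericPoint E) * B.formAt f F (genericPoint E))) fun x hx => by
    obtain ⟨l, hl⟩ := exists_algebraMap_formAt_mul_formAt A B f x
    obtain ⟨w, hw⟩ := (hFx x hx).symm.mul_mul (hGx x hx)
    refine ⟨w, (eq_div_iff hden).mpr (mul_left_cancel₀ (pow_ne_zero n l.ne_zero) ?_)⟩
    rw [← hl F G n hF hG, mul_left_comm, ← hl G F n hG hF, ← map_mul, ← mul_comm]
    exact congrArg _ (by linear_combination hw)
  rw [eq_div_iff hden] at hc
  refine ⟨c, fun x => IsFractionRing.injective (E.presheaf.stalk x) E.functionField ?_⟩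
  obtain ⟨l, hl⟩ := exists_algebraMap_formAt_mul_formAt A B f x
  have hcx : algebraMap (E.presheaf.stalk x) E.functionField (constGerm f x c) =
      constGerm f (genericPoint E) c := stalkSpecializes_constGerm f _ c
  rw [hl F G n hF hG, map_mul, hl G F n hG hF, hcx, ← hc, mul_left_comm]

end FunctionField

section SamePullback

variable {K : Type u} [Field K] {E P : Scheme.{u}} {q : P ⟶ SpecOf K}
  {C : ProjectiveCoordinate P}

/-- The morphisms `φ` and `ψ` pull the finite set `S` of values of `C` back to the same divisor:
they have the same preimage of `S` among the rational points, and the same ramification indices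
there. -/
def HasSamePullback (C : ProjectiveCoordinate P) (f : E ⟶ SpecOf K) (φ ψ : E ⟶ P)
    (S : Finset (OnePoint K)) : Prop :=
  ∀ s : SpecOf K ⟶ E, s ≫ f = 𝟙 _ → (C.value (s ≫ φ) ∈ S ↔ C.value (s ≫ ψ) ∈ S) ∧
    (C.value (s ≫ φ) ∈ S → ramificationIndexAt φ (s (IsLocalRing.closedPoint K)) =
      ramificationIndexAt ψ (s (IsLocalRing.closedPoint K)))

variable {f : E ⟶ SpecOf K} {φ ψ : E ⟶ P} {S S' : Finset (OnePoint K)} [IsIntegral E]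

lemma HasSamePullback.formAt_vanishingForm_pow_ne_zero (h : C.HasSamePullback f φ ψ S)
    (hS : ∃ s : SpecOf K ⟶ E, s ≫ f = 𝟙 _ ∧ C.value (s ≫ φ) ∉ S) (m : ℕ) (x : E) :
    (C.pullback φ).formAt f (vanishingForm S ^ m) x ≠ 0 ∧
      (C.pullback ψ).formAt f (vanishingForm S ^ m) x ≠ 0 := by
  obtain ⟨s, hs, hsS⟩ := hS
  have hsS' := (h s hs).1.not.mp hsS
  rw [C.value_comp] at hsS hsS'
  have eval_ne_zero {d : OnePoint K} (hd : d ∉ S) :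
      eval (homCoord d) (vanishingForm S ^ m) ≠ 0 := by
    rw [map_pow]
    exact pow_ne_zero m (eval_vanishingForm_eq_zero_iff.not.mpr hd)
  have hhom := (isHomogeneous_vanishingForm S).pow m
  exact ⟨formAt_ne_zero _ f hhom hs (eval_ne_zero hsS) x,
    formAt_ne_zero _ f hhom hs (eval_ne_zero hsS') x⟩

lemma IsEmbedding.associated_formAt_vanishingForm_pow [IsAlgClosed K]
    [SmoothOfRelativeDimension 1 f] (hC : C.IsEmbedding q) (hφ : φ ≫ q = f) (hψ : ψ ≫ q = f)
    (h : C.HasSamePullback f φ ψ S)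
    (hS : ∃ s : SpecOf K ⟶ E, s ≫ f = 𝟙 _ ∧ C.value (s ≫ φ) ∉ S) (m : ℕ) {x : E}
    (hx : IsClosed {x}) :
    Associated ((C.pullback φ).formAt f (vanishingForm S ^ m) x)
      ((C.pullback ψ).formAt f (vanishingForm S ^ m) x) := by
  have : Smooth f := SmoothOfRelativeDimension.smooth 1 f
  have hs := pointOfClosedPoint_comp f x hx
  obtain ⟨hmem, hram⟩ := h _ hs
  have h0 := h.formAt_vanishingForm_pow_ne_zero hS 1
  rw [← pointOfClosedPoint_apply f x hx (IsLocalRing.closedPoint K)]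
  simp only [pow_one] at h0
  simpa only [formAt, eval₂_pow] using
    (hC.associated_formAt_vanishingForm hφ hψ hs (h0 _).1 (h0 _).2 hmem hram).pow_pow

lemma IsEmbedding.exists_eval_mul_eval_eq [IsAlgClosed K] [UniversallyClosed f]
    [SmoothOfRelativeDimension 1 f] (hC : C.IsEmbedding q) (hφ : φ ≫ q = f) (hψ : ψ ≫ q = f)
    (h : C.HasSamePullback f φ ψ S) (h' : C.HasSamePullback f φ ψ S')
    (hS : ∃ s : SpecOf K ⟶ E, s ≫ f = 𝟙 _ ∧ C.value (s ≫ φ) ∉ S)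
    (hS' : ∃ s : SpecOf K ⟶ E, s ≫ f = 𝟙 _ ∧ C.value (s ≫ φ) ∉ S') {m m' : ℕ}
    (hdeg : S.card * m = S'.card * m') :
    ∃ c : Kˣ, ∀ s : SpecOf K ⟶ E, s ≫ f = 𝟙 _ →
      eval (homCoord (C.value (s ≫ φ))) (vanishingForm S ^ m) *
          eval (homCoord (C.value (s ≫ ψ))) (vanishingForm S' ^ m') =
        c * (eval (homCoord (C.value (s ≫ φ))) (vanishingForm S' ^ m') *
          eval (homCoord (C.value (s ≫ ψ))) (vanishingForm S ^ m)) := by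
  have h0 := h.formAt_vanishingForm_pow_ne_zero hS m (genericPoint E)
  have h0' := h'.formAt_vanishingForm_pow_ne_zero hS' m' (genericPoint E)
  obtain ⟨c, hc⟩ := exists_formAt_mul_formAt_eq (C.pullback φ) (C.pullback ψ) f
    ((isHomogeneous_vanishingForm S).pow m) (hdeg ▸ (isHomogeneous_vanishingForm S').pow m')
    h0'.1 h0.2 (fun x => hC.associated_formAt_vanishingForm_pow hφ hψ h hS m)
    (fun x => hC.associated_formAt_vanishingForm_pow hφ hψ h' hS' m')
  have hc0 : c ≠ 0 := by
    rintro rfl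
    exact mul_ne_zero h0.1 h0'.2 (by rw [hc, map_zero, zero_mul])
  refine ⟨Units.mk0 c hc0, fun s hs => ?_⟩
  have heval := congrArg (evalAt s) (hc (s (IsLocalRing.closedPoint K)))
  simpa only [map_mul, evalAt_formAt _ hs, evalAt_constGerm hs, ← C.value_comp,
    Units.val_mk0] using heval

end SamePullback

end ProjectiveCoordinate

instance isProper_projectiveLineToSpec (k : Type u) [Field k] :
    IsProper (projectiveLineToSpec k) := by
  let := MvPolynomial.gradedAlgebra (σ := Fin 2) (R := k)
  have : IsClosedImmersion (Spec.map (CommRingCat.ofHom (algebraMap k (grading k 0)))) :=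
    IsClosedImmersion.spec_of_surjective _ algebraMap_grading_zero_surjective
  have : IsScalarTower k (grading k 0) (MvPolynomial (Fin 2) k) :=
    ⟨fun a b c => smul_mul_assoc a (b : MvPolynomial (Fin 2) k) c⟩
  have : Algebra.FiniteType (grading k 0) (MvPolynomial (Fin 2) k) :=
    Algebra.FiniteType.of_restrictScalars_finiteType k _ _
  have : IsProper (Proj.toSpecZero (grading k)) := inferInstance
  exact inferInstanceAs (IsProper (Proj.toSpecZero (grading k) ≫ _))

section BaseChange

variable {k : Type u} [Field k] {K : Type u} [Field K] [Algebra k K] {X Y Z : Scheme.{u}}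
  {x : X ⟶ SpecOf k} {y : Y ⟶ SpecOf k} {z : Z ⟶ SpecOf k}

lemma baseChangeMap_fst (f : X ⟶ Y) (hf : f ≫ y = x) :
    baseChangeMap K f hf ≫ pullback.fst y (specMap k K) = pullback.fst x (specMap k K) ≫ f :=
  pullback.lift_fst _ _ _

lemma baseChangeMap_snd (f : X ⟶ Y) (hf : f ≫ y = x) :
    baseChangeMap K f hf ≫ pullback.snd y (specMap k K) = pullback.snd x (specMap k K) :=
  pullback.lift_snd _ _ _

lemma baseChangeMap_comp (g : Z ⟶ X) (hg : g ≫ x = z) (f : X ⟶ Y) (hf : f ≫ y = x)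
    (h : (g ≫ f) ≫ y = z) :
    baseChangeMap K (g ≫ f) h = baseChangeMap K g hg ≫ baseChangeMap K f hf := by
  apply pullback.hom_ext
  · rw [Category.assoc, baseChangeMap_fst, baseChangeMap_fst, reassoc_of% (baseChangeMap_fst g hg)]
  · rw [Category.assoc, baseChangeMap_snd, baseChangeMap_snd, baseChangeMap_snd]

lemma isPullback_baseChangeMap (f : X ⟶ Y) (hf : f ≫ y = x) :
    IsPullback (pullback.fst x (specMap k K)) (baseChangeMap K f hf) f
      (pullback.fst y (specMap k K)) := by
  refine (IsPullback.of_right (h₁₂ := pullback.snd y (specMap k K)) ?_ (baseChangeMap_fst f hf)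
    (IsPullback.of_hasPullback y (specMap k K)).flip).flip
  rw [baseChangeMap_snd, hf]
  exact (IsPullback.of_hasPullback x (specMap k K)).flip

lemma lift_fst (p : Points K x) : Points.lift p ≫ pullback.fst x (specMap k K) = p.1 :=
  pullback.lift_fst _ _ _

lemma lift_snd (p : Points K x) : Points.lift p ≫ pullback.snd x (specMap k K) = 𝟙 _ :=
  pullback.lift_snd _ _ _

lemma lift_injective : Function.Injective (Points.lift (K := K) (x := x)) := fun p p' h =>
  Subtype.ext (by rw [← lift_fst p, h, lift_fst p'])

lemma exists_lift_eq (s : SpecOf K ⟶ baseChange K x)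
    (hs : s ≫ pullback.snd x (specMap k K) = 𝟙 _) : ∃ p : Points K x, Points.lift p = s := by
  refine ⟨⟨s ≫ pullback.fst x (specMap k K), ?_⟩, ?_⟩
  · rw [Category.assoc, pullback.condition, reassoc_of% hs]
  · apply pullback.hom_ext
    · exact lift_fst _
    · exact (lift_snd _).trans hs.symm

lemma lift_map (f : X ⟶ Y) (hf : f ≫ y = x) (p : Points K x) :
    Points.lift (p.map f hf) = Points.lift p ≫ baseChangeMap K f hf := by
  apply pullback.hom_ext
  · rw [Category.assoc, baseChangeMap_fst, lift_fst, reassoc_of% lift_fst p, Points.map]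
  · rw [Category.assoc, baseChangeMap_snd, lift_snd, lift_snd]

/-- A dominant morphism of proper schemes is surjective, and the fibre of its base change over a
rational point contains a closed point. -/
lemma points_map_surjective [IsAlgClosed K] [IsProper x] [IsProper y] (f : X ⟶ Y) (hf : f ≫ y = x)
    [IsDominant f] : Function.Surjective (Points.map (K := K) f hf) := by
  intro p
  have : UniversallyClosed (f ≫ y) := by rw [hf]; infer_instance
  have : UniversallyClosed f := UniversallyClosed.of_comp_of_isSeparated f y
  have hsurj : Surjective (baseChangeMap K f hf) :=
    MorphismProperty.IsStableUnderBaseChange.of_isPullback (isPullback_baseChangeMap f hf)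
      (inferInstanceAs (Surjective f))
  have : CompactSpace (baseChange K x) :=
    (quasiCompact_iff_compactSpace (pullback.snd x (specMap k K))).mp inferInstance
  have hp : IsClosed {p.toBaseChange} :=
    (pointEquivClosedPoint (pullback.snd y (specMap k K)) ⟨Points.lift p, lift_snd p⟩).2
  obtain ⟨a, ha, hac⟩ := (hp.preimage
    (baseChangeMap K f hf).continuous).exists_closed_singleton
    (hsurj.surj.nonempty_preimage.mpr (Set.singleton_nonempty _))
  obtain ⟨w, hw⟩ := exists_lift_eq _ (pointOfClosedPoint_comp (pullback.snd x (specMap k K)) a hac)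
  refine ⟨w, lift_injective (ext_of_apply_closedPoint_eq (pullback.snd y (specMap k K))
    (lift_snd _) (lift_snd _) ?_)⟩
  rw [lift_map, hw]
  exact (congrArg (baseChangeMap K f hf) (pointOfClosedPoint_apply _ a hac _)).trans ha

end BaseChange

section Component

lemma ramificationIndexAt_comp_of_isOpenImmersion {X Y Z : Scheme.{u}} (j : X ⟶ Y)
    [IsOpenImmersion j] (φ : Y ⟶ Z) (x : X) :
    ramificationIndexAt (j ≫ φ) x = ramificationIndexAt φ (j x) := by
  let := (φ.stalkMap (j x)).hom.toAlgebra
  let : Algebra (Z.presheaf.stalk (φ (j x))) (X.presheaf.stalk x) :=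
    ((j ≫ φ).stalkMap x).hom.toAlgebra
  let e : Y.presheaf.stalk (j x) ≃ₐ[Z.presheaf.stalk (φ (j x))] X.presheaf.stalk x :=
    AlgEquiv.ofRingEquiv (f := (asIso (j.stalkMap x)).commRingCatIsoToRingEquiv)
      fun r => congr($(Scheme.Hom.stalkMap_comp j φ x).hom r).symm
  have hcomap : (IsLocalRing.maximalIdeal (X.presheaf.stalk x)).comap e =
      IsLocalRing.maximalIdeal (Y.presheaf.stalk (j x)) :=
    Ideal.ext fun a => not_congr (MulEquiv.isUnit_map e)
  exact (Ideal.ramificationIdx'_comap_eq _ e _).symm.trans (congrArg _ hcomap)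

variable {k : Type u} [Field k] {K : Type u} [Field K] [Algebra k K] {P X : Scheme.{u}}
  {q : P ⟶ SpecOf k}

lemma ramificationIndex_map_ι {d : X ⟶ SpecOf k} (U : X.Opens) {π : X ⟶ P} (h : π ≫ q = d)
    (hU : (U.ι ≫ π) ≫ q = U.ι ≫ d) (w : Points K (U.ι ≫ d)) :
    ramificationIndex (U.ι ≫ π) hU w = ramificationIndex π h (w.map U.ι rfl) := by
  have : IsOpenImmersion (baseChangeMap K U.ι (rfl : U.ι ≫ d = U.ι ≫ d)) :=
    MorphismProperty.IsStableUnderBaseChange.of_isPullback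
      (isPullback_baseChangeMap U.ι (rfl : U.ι ≫ d = U.ι ≫ d)) inferInstance
  rw [ramificationIndex, baseChangeMap_comp U.ι rfl π h,
    ramificationIndexAt_comp_of_isOpenImmersion, ramificationIndex, Points.toBaseChange,
    Points.toBaseChange, lift_map]
  rfl

lemma exists_map_ι_eq {d : X ⟶ SpecOf k} (U : X.Opens) {z : Points K d}
    (hz : z.1 (IsLocalRing.closedPoint K) ∈ U) : ∃ w : Points K (U.ι ≫ d), w.map U.ι rfl = z := by
  have hrange : Set.range z.1 ⊆ Set.range U.ι := by
    rintro _ ⟨y, rfl⟩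
    rw [show y = IsLocalRing.closedPoint K from Subsingleton.elim (α := PrimeSpectrum K) _ _]
    simpa using hz
  refine ⟨⟨IsOpenImmersion.lift U.ι z.1 hrange, ?_⟩, Subtype.ext (IsOpenImmersion.lift_fac _ _ _)⟩
  rw [IsOpenImmersion.lift_fac_assoc, z.2]

lemma smoothOfRelativeDimension_baseChange (d : X ⟶ SpecOf k) [SmoothOfRelativeDimension 1 d] :
    SmoothOfRelativeDimension 1 (pullback.snd d (specMap k K)) :=
  (smoothOfRelativeDimension_isStableUnderBaseChange 1).of_isPullback
    (IsPullback.of_hasPullback d (specMap k K)) inferInstance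

lemma isIntegral_baseChange [IsAlgClosed K] (d : X ⟶ SpecOf k) [SmoothOfRelativeDimension 1 d]
    [GeometricallyIrreducible d] : IsIntegral (baseChange K d) := by
  have : IrreducibleSpace (baseChange K d) :=
    GeometricallyIrreducible.geometrically_irreducibleSpace (f := d) _ _ _
      (IsPullback.of_hasPullback _ _)
  have := smoothOfRelativeDimension_baseChange (K := K) d
  have := isReduced_of_smoothOfRelativeDimension_one (pullback.snd d (specMap k K))
  exact isIntegral_of_irreducibleSpace_of_isReduced _

end Component

lemma ProjectiveCoordinate.IsEmbedding.exists_vanishingRatio_eq {K : Type u} [Field K]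
    [IsAlgClosed K] {E P : Scheme.{u}} [IsIntegral E] {q : P ⟶ SpecOf K}
    {C : ProjectiveCoordinate P} (hC : C.IsEmbedding q) {f : E ⟶ SpecOf K} [UniversallyClosed f]
    [SmoothOfRelativeDimension 1 f] {φ ψ : E ⟶ P} (hφ : φ ≫ q = f) (hψ : ψ ≫ q = f)
    {S S' : Finset (OnePoint K)} (h : C.HasSamePullback f φ ψ S) (h' : C.HasSamePullback f φ ψ S')
    (hS : ∃ s : SpecOf K ⟶ E, s ≫ f = 𝟙 _ ∧ C.value (s ≫ φ) ∉ S)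
    (hS' : ∃ s : SpecOf K ⟶ E, s ≫ f = 𝟙 _ ∧ C.value (s ≫ φ) ∉ S') (hne : S.Nonempty) :
    ∃ c : Kˣ, ∀ s : SpecOf K ⟶ E, s ≫ f = 𝟙 _ →
      vanishingRatio S S' (C.value (s ≫ φ)) = c * vanishingRatio S S' (C.value (s ≫ ψ)) := by
  obtain ⟨c, hc⟩ := hC.exists_eval_mul_eval_eq hφ hψ h h' hS hS' (mul_comm S.card S'.card)
  refine ⟨c, fun s hs => ?_⟩
  by_cases hmem : C.value (s ≫ φ) ∈ S'
  · rw [vanishingRatio_eq_zero_of_mem_right hne hmem,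
      vanishingRatio_eq_zero_of_mem_right hne ((h' s hs).1.mp hmem), mul_zero]
  have eval_ne_zero {d : OnePoint K} (hd : d ∉ S') :
      MvPolynomial.eval (homCoord d) (vanishingForm S' ^ S.card) ≠ 0 := by
    rw [map_pow]
    exact pow_ne_zero _ (eval_vanishingForm_eq_zero_iff.not.mpr hd)
  rw [vanishingRatio, vanishingRatio, ← mul_div_assoc,
    div_eq_div_iff (eval_ne_zero hmem) (eval_ne_zero ((h' s hs).1.not.mp hmem)), hc s hs]
  ring

section Values

variable {k : Type u} [Field k] {K : Type u} [Field K] [Algebra k K] {P : Scheme.{u}}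
  {q : P ⟶ SpecOf k} (C : ProjectiveCoordinate P)

lemma value_lift (p : Points K q) :
    (C.pullback (pullback.fst q (specMap k K))).value (Points.lift p) = C.value p.1 := by
  rw [← C.value_comp, lift_fst]

variable {C} in
lemma ProjectiveCoordinate.IsEmbedding.value_points_injective (hC : C.IsEmbedding q) :
    Function.Injective fun p : Points K q => C.value p.1 := fun p p' h =>
  lift_injective (hC.baseChange.value_injective (lift_snd p) (lift_snd p')
    (by rw [value_lift, value_lift]; exact h))

/-- The set of values of a projective coordinate on a finite set of points. -/
def valueFinset {S : Set (Points K q)} (hS : S.Finite) : Finset (OnePoint K) :=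
  (hS.image fun p => C.value p.1).toFinset

variable {C} in
lemma ProjectiveCoordinate.IsEmbedding.value_mem_valueFinset (hC : C.IsEmbedding q)
    {S : Set (Points K q)} (hS : S.Finite) {p : Points K q} :
    C.value p.1 ∈ valueFinset C hS ↔ p ∈ S := by
  rw [valueFinset, Set.Finite.mem_toFinset]
  exact hC.value_points_injective.mem_set_image

lemma valueFinset_nonempty {S : Set (Points K q)} (hS : S.Finite) (hne : S.Nonempty) :
    (valueFinset C hS).Nonempty :=
  (Set.Finite.toFinset_nonempty _).mpr (hne.image _)

variable {C} in
lemma ProjectiveCoordinate.IsEmbedding.disjoint_valueFinset (hC : C.IsEmbedding q)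
    {S S' : Set (Points K q)} (hS : S.Finite) (hS' : S'.Finite) (h : Disjoint S S') :
    Disjoint (valueFinset C hS) (valueFinset C hS') :=
  Set.Finite.disjoint_toFinset.mpr
    ((Set.disjoint_image_iff hC.value_points_injective).mpr h)

/-- The function on points with divisor of zeros proportional to `S` and divisor of poles
proportional to `S'`. Its value at the poles is zero. -/
def pointRatio {S S' : Set (Points K q)} (hS : S.Finite) (hS' : S'.Finite) (p : Points K q) : K :=
  vanishingRatio (valueFinset C hS) (valueFinset C hS') (C.value p.1)

variable {C} in
lemma ProjectiveCoordinate.IsEmbedding.pointRatio_ne_zero (hC : C.IsEmbedding q)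
    {S S' : Set (Points K q)} (hS : S.Finite) (hS' : S'.Finite) {p : Points K q} (hp : p ∉ S)
    (hp' : p ∉ S') : pointRatio C hS hS' p ≠ 0 :=
  vanishingRatio_ne_zero ((hC.value_mem_valueFinset hS).not.mpr hp)
    ((hC.value_mem_valueFinset hS').not.mpr hp')

variable {C} in
lemma ProjectiveCoordinate.IsEmbedding.exists_encard_pointRatio_pow_fibre_le
    (hC : C.IsEmbedding q) {S S' : Set (Points K q)} (hS : S.Finite) (hS' : S'.Finite)
    (h : Disjoint S S') (hne : S.Nonempty) (hne' : S'.Nonempty) {N : ℕ} (hN : N ≠ 0) :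
    ∃ M : ℕ, ∀ r : K, {p | pointRatio C hS hS' p ^ N = r}.encard ≤ M := by
  set A := valueFinset C hS
  set A' := valueFinset C hS'
  refine ⟨A.card * A'.card * N + A.card * A'.card + 1, fun r => ?_⟩
  calc {p | pointRatio C hS hS' p ^ N = r}.encard
    _ ≤ {d | vanishingRatio A A' d ^ N = r}.encard :=
      Set.encard_le_encard_of_injOn (f := fun p => C.value p.1) (fun _ hp => hp)
        hC.value_points_injective.injOn
    _ ≤ ((A.card * A'.card * N + A.card * A'.card : ℕ) : ℕ∞) + 1 :=
      encard_vanishingRatio_pow_fibre_le (hC.disjoint_valueFinset hS hS' h)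
        (valueFinset_nonempty C hS hne) (valueFinset_nonempty C hS' hne') hN r
    _ = _ := (Nat.cast_succ _).symm

variable {C} in
lemma exists_value_notMem [IsAlgClosed K] [IsProper q] (hC : C.IsEmbedding q)
    {S : Set (Points K q)} (hS : S.Finite) {p : Points K q} (hp : p ∉ S) {X : Scheme.{u}}
    {x : X ⟶ SpecOf k} [IsProper x] (φ : X ⟶ P) [IsDominant φ] (hφ : φ ≫ q = x) :
    ∃ s : SpecOf K ⟶ baseChange K x, s ≫ pullback.snd x (specMap k K) = 𝟙 _ ∧
      (C.pullback (pullback.fst q (specMap k K))).value (s ≫ baseChangeMap K φ hφ) ∉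
        valueFinset C hS := by
  obtain ⟨w, rfl⟩ := points_map_surjective φ hφ p
  exact ⟨Points.lift w, lift_snd w, by rwa [← lift_map, value_lift, hC.value_mem_valueFinset]⟩

end Values

end SelfCorr

namespace SelfCorrespondence

open SelfCorr

variable {k : Type u} [Field k] {K : Type u} [Field K] [Algebra k K] {P : Scheme.{u}}
  {q : P ⟶ SpecOf k} (D : SelfCorrespondence q)

lemma ι_π₁_comp (U : D.D.Opens) : (U.ι ≫ D.π₁) ≫ q = U.ι ≫ D.d := by
  rw [Category.assoc, D.π₁_comp]

lemma ι_π₂_comp (U : D.D.Opens) : (U.ι ≫ D.π₂) ≫ q = U.ι ≫ D.d := by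
  rw [Category.assoc, D.π₂_comp]

lemma src_map_ι (U : D.D.Opens) (w : Points K (U.ι ≫ D.d)) :
    D.src (w.map U.ι rfl) = w.map (U.ι ≫ D.π₁) (D.ι_π₁_comp U) :=
  Subtype.ext (Category.assoc _ _ _)

lemma tgt_map_ι (U : D.D.Opens) (w : Points K (U.ι ≫ D.d)) :
    D.tgt (w.map U.ι rfl) = w.map (U.ι ≫ D.π₂) (D.ι_π₂_comp U) :=
  Subtype.ext (Category.assoc _ _ _)

lemma isProper_ι_comp {U : D.D.Opens} (hU : IsClosed (U : Set D.D)) : IsProper (U.ι ≫ D.d) := by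
  have : IsClosedImmersion U.ι := IsClosedImmersion.of_isPreimmersion U.ι (by simpa using hU)
  have := D.isProper
  infer_instance

lemma smooth_ι_comp (U : D.D.Opens) : SmoothOfRelativeDimension 1 (U.ι ≫ D.d) :=
  have := D.smooth
  inferInstanceAs (SmoothOfRelativeDimension (0 + 1) (U.ι ≫ D.d))

variable {C : ProjectiveCoordinate P}

lemma hasSamePullback_ι (U : D.D.Opens) {S : Set (Points K q)} (hS : D.IsComplete S)
    (hSe : D.IsEquiramified S) {A : Finset (OnePoint K)}
    (hA : ∀ p : Points K q, C.value p.1 ∈ A ↔ p ∈ S) :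
    (C.pullback (pullback.fst q (specMap k K))).HasSamePullback
      (pullback.snd (U.ι ≫ D.d) (specMap k K)) (baseChangeMap K (U.ι ≫ D.π₁) (D.ι_π₁_comp U))
      (baseChangeMap K (U.ι ≫ D.π₂) (D.ι_π₂_comp U)) A := by
  intro s hs
  obtain ⟨w, rfl⟩ := exists_lift_eq s hs
  have hmem : D.src (w.map U.ι rfl) ∈ S ↔ D.tgt (w.map U.ι rfl) ∈ S := Set.ext_iff.mp hS _
  simp only [← lift_map, value_lift, hA, ← src_map_ι, ← tgt_map_ι]
  refine ⟨hmem, fun h => ?_⟩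
  exact (ramificationIndex_map_ι U D.π₁_comp (D.ι_π₁_comp U) w).trans
    ((hSe _ h (hmem.mp h)).trans (ramificationIndex_map_ι U D.π₂_comp (D.ι_π₂_comp U) w).symm)

lemma exists_tgt_eq [IsProper q] [IsAlgClosed K] (x : D.D) (p : Points K q) :
    ∃ z : Points K D.d, z.1 (IsLocalRing.closedPoint K) ∈ connectedComponent x ∧ D.tgt z = p := by
  obtain ⟨U, hU, -, -, h₂⟩ := D.component x
  have := D.isProper_ι_comp (U := U) (hU ▸ isClosed_connectedComponent)
  have := h₂.isDominant
  obtain ⟨w, rfl⟩ := points_map_surjective (K := K) (U.ι ≫ D.π₂) (D.ι_π₂_comp U) p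
  refine ⟨w.map U.ι rfl, ?_, D.tgt_map_ι U w⟩
  rw [← hU]
  exact (w.1 (IsLocalRing.closedPoint K)).2

lemma exists_pointRatio_src_eq [IsProper q] [IsAlgClosed K] (hC : C.IsEmbedding q)
    {S S' : Set (Points K q)} (hS : D.IsComplete S) (hSf : S.Finite) (hSe : D.IsEquiramified S)
    (hSn : S.Nonempty) (hS' : D.IsComplete S') (hSf' : S'.Finite) (hSe' : D.IsEquiramified S')
    (hSn' : S'.Nonempty) (hd : Disjoint S S') (x : D.D) :
    ∃ c : Kˣ, ∀ z : Points K D.d, z.1 (IsLocalRing.closedPoint K) ∈ connectedComponent x →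
      pointRatio C hSf hSf' (D.src z) = c * pointRatio C hSf hSf' (D.tgt z) := by
  obtain ⟨U, hU, _, h₁, -⟩ := D.component x
  have := D.isProper_ι_comp (U := U) (hU ▸ isClosed_connectedComponent)
  have := D.smooth_ι_comp U
  have := h₁.isDominant
  have := isIntegral_baseChange (K := K) (U.ι ≫ D.d)
  have := smoothOfRelativeDimension_baseChange (K := K) (U.ι ≫ D.d)
  have hmem {T : Set (Points K q)} (hT : T.Finite) := fun p : Points K q =>
    hC.value_mem_valueFinset hT (p := p)
  obtain ⟨c, hc⟩ := hC.baseChange.exists_vanishingRatio_eq (baseChangeMap_snd _ _)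
    (baseChangeMap_snd _ _) (D.hasSamePullback_ι U hS hSe (hmem hSf))
    (D.hasSamePullback_ι U hS' hSe' (hmem hSf'))
    (exists_value_notMem hC hSf (hd.notMem_of_mem_right hSn'.some_mem) _ (D.ι_π₁_comp U))
    (exists_value_notMem hC hSf' (hd.notMem_of_mem_left hSn.some_mem) _ (D.ι_π₁_comp U))
    (valueFinset_nonempty C hSf hSn)
  refine ⟨c, fun z hz => ?_⟩
  obtain ⟨w, rfl⟩ := exists_map_ι_eq U (hU ▸ hz : z.1 (IsLocalRing.closedPoint K) ∈ (U : Set D.D))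
  simpa only [pointRatio, ← lift_map, value_lift, ← src_map_ι, ← tgt_map_ι] using hc _ (lift_snd w)

lemma finite_connectedComponents : Finite (_root_.ConnectedComponents D.D) := by
  have := D.isProper
  have : CompactSpace D.D := (quasiCompact_iff_compactSpace D.d).mp inferInstance
  have : DiscreteTopology (_root_.ConnectedComponents D.D) :=
    _root_.ConnectedComponents.discreteTopology_iff.mpr fun x => by
      obtain ⟨U, hU, -⟩ := D.component x
      exact hU ▸ U.2
  exact finite_of_compact_of_discrete

/-- The connected component of `D` on which a point lies. -/
def componentOf (z : Points K D.d) : _root_.ConnectedComponents D.D :=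
  (z.1 (IsLocalRing.closedPoint K) : D.D)

lemma exists_componentOf_eq_and_tgt_eq [IsProper q] [IsAlgClosed K]
    (j : _root_.ConnectedComponents D.D) (p : Points K q) :
    ∃ z : Points K D.d, D.componentOf z = j ∧ D.tgt z = p := by
  obtain ⟨x, rfl⟩ := _root_.ConnectedComponents.surjective_coe j
  obtain ⟨z, hz, hp⟩ := D.exists_tgt_eq x p
  exact ⟨z, _root_.ConnectedComponents.coe_eq_coe'.mpr hz, hp⟩

/-- The divisor of `F / G` is preserved by the correspondence, so on each component of `D` the
pullbacks of `F / G` along `π₁` and `π₂` differ by a constant; the finite set of nonzero values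
of `F / G` on `T` is stable under multiplication by these constants. -/
lemma exists_pow_pointRatio_src_eq [IsProper q] [IsAlgClosed K] (hC : C.IsEmbedding q)
    {S S' T : Set (Points K q)} (hS : D.IsIrreducibleComplete S) (hSf : S.Finite)
    (hSe : D.IsEquiramified S) (hS' : D.IsIrreducibleComplete S') (hSf' : S'.Finite)
    (hSe' : D.IsEquiramified S') (hd : Disjoint S S') (hT : D.IsIrreducibleComplete T)
    (hTf : T.Finite) (hTS : Disjoint T S) (hTS' : Disjoint T S') :
    ∃ N ≠ 0, ∀ z : Points K D.d,
      pointRatio C hSf hSf' (D.src z) ^ N = pointRatio C hSf hSf' (D.tgt z) ^ N := by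
  have := D.finite_connectedComponents
  have hconst (j : _root_.ConnectedComponents D.D) : ∃ c : Kˣ, ∀ z : Points K D.d,
      D.componentOf z = j →
        pointRatio C hSf hSf' (D.src z) = c * pointRatio C hSf hSf' (D.tgt z) := by
    obtain ⟨x, rfl⟩ := _root_.ConnectedComponents.surjective_coe j
    simpa only [componentOf, _root_.ConnectedComponents.coe_eq_coe'] using
      D.exists_pointRatio_src_eq hC hS.1.2 hSf hSe hS.1.1 hS'.1.2 hSf' hSe' hS'.1.1 hd x
  choose c hc using hconst
  obtain ⟨p, hp⟩ := hT.1.1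
  exact exists_pow_invariant (s := D.src) (t := D.tgt) (i := D.componentOf) (fun z => hc _ z rfl)
    D.exists_componentOf_eq_and_tgt_eq hT.1.2 hTf
    ⟨p, hp, hC.pointRatio_ne_zero hSf hSf' (hTS.notMem_of_mem_left hp)
      (hTS'.notMem_of_mem_left hp)⟩

theorem eq_or_eq_of_not_isFinitary [IsProper q] [IsAlgClosed K] (hC : C.IsEmbedding q)
    (hD : ¬ D.IsFinitary K) {S S' T : Set (Points K q)} (hS : D.IsIrreducibleComplete S)
    (hSf : S.Finite) (hSe : D.IsEquiramified S) (hS' : D.IsIrreducibleComplete S')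
    (hSf' : S'.Finite) (hSe' : D.IsEquiramified S') (hne : S ≠ S')
    (hT : D.IsIrreducibleComplete T) (hTf : T.Finite) : T = S ∨ T = S' := by
  have hd : Disjoint S S' := (IsIrreducibleCompleteSet.eq_or_disjoint hS hS').resolve_left hne
  by_contra! hTne
  have hTS := (IsIrreducibleCompleteSet.eq_or_disjoint hT hS).resolve_left hTne.1
  have hTS' := (IsIrreducibleCompleteSet.eq_or_disjoint hT hS').resolve_left hTne.2
  obtain ⟨N, hN, hinv⟩ :=
    D.exists_pow_pointRatio_src_eq hC hS hSf hSe hS' hSf' hSe' hd hT hTf hTS hTS'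
  obtain ⟨M, hM⟩ :=
    hC.exists_encard_pointRatio_pow_fibre_le hSf hSf' hd hS.1.1 hS'.1.1 hN
  refine hD ⟨M, fun A hA => ?_⟩
  obtain ⟨p, hp⟩ := hA.1.1
  exact (Set.encard_le_encard (IsIrreducibleCompleteSet.subset_fibre hA hinv hp)).trans (hM _)

end SelfCorrespondence

end

theorem mainTheorem7_general (k : Type u) [Field k] (K : Type u) [Field K] [Algebra k K]
    [IsAlgClosed K] (D : SelfCorrespondence (SelfCorr.projectiveLineToSpec k))
    (hD : ¬ D.IsFinitary K) :
    {S : Set (SelfCorr.Points K (SelfCorr.projectiveLineToSpec k)) |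
        D.IsIrreducibleComplete S ∧ S.Finite ∧ D.IsEquiramified S}.encard ≤ 2 ∧
      ∀ S S' : Set (SelfCorr.Points K (SelfCorr.projectiveLineToSpec k)),
        D.IsIrreducibleComplete S → S.Finite → D.IsEquiramified S →
        D.IsIrreducibleComplete S' → S'.Finite → D.IsEquiramified S' →
        S ≠ S' →
        ∀ T : Set (SelfCorr.Points K (SelfCorr.projectiveLineToSpec k)),
          D.IsIrreducibleComplete T → T.Finite → T = S ∨ T = S' := by
  have eq_or_eq {S S' T : Set (SelfCorr.Points K (SelfCorr.projectiveLineToSpec k))} :=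
    D.eq_or_eq_of_not_isFinitary SelfCorr.isEmbedding_standardCoordinate hD (S := S) (S' := S')
      (T := T)
  refine ⟨SelfCorr.encard_le_two_of_forall_eq_or_eq ?_, ?_⟩
  · rintro S ⟨hS, hSf, hSe⟩ S' ⟨hS', hSf', hSe'⟩ hne T ⟨hT, hTf, -⟩
    exact eq_or_eq hS hSf hSe hS' hSf' hSe' hne hT hTf
  · intro S S' hS hSf hSe hS' hSf' hSe' hne T hT hTf
    exact eq_or_eq hS hSf hSe hS' hSf' hSe' hne hT hTf

theorem mainTheorem7 (k : Type u) [Field k] (K : Type u) [Field K] [Algebra k K]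
    [IsAlgClosure k K] (D : SelfCorrespondence (SelfCorr.projectiveLineToSpec k))
    (hD : ¬ D.IsFinitary K) :
    {S : Set (SelfCorr.Points K (SelfCorr.projectiveLineToSpec k)) |
        D.IsIrreducibleComplete S ∧ S.Finite ∧ D.IsEquiramified S}.encard ≤ 2 ∧
      ∀ S S' : Set (SelfCorr.Points K (SelfCorr.projectiveLineToSpec k)),
        D.IsIrreducibleComplete S → S.Finite → D.IsEquiramified S →
        D.IsIrreducibleComplete S' → S'.Finite → D.IsEquiramified S' →
        S ≠ S' →
        ∀ T : Set (SelfCorr.Points K (SelfCorr.projectiveLineToSpec k)),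
          D.IsIrreducibleComplete T → T.Finite → T = S ∨ T = S' := by
  have : IsAlgClosed K := IsAlgClosure.isAlgClosed k
  exact mainTheorem7_general k K D hD
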